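/- Let $K$ be an algebraically closed field of characteristic zero. Let $A=(a_{ij})_{1\le i\le 4,\,0\le j\le 3}$ be a matrix of non-negative integers with $\det A\neq 0$, with all row sums equal to one integer $d$, and with third column $(a_{12},a_{22},a_{32},a_{42})=(0,0,0,1)$. Let $F=\sum_{i=1}^4\prod_{j=0}^3X_j^{a_{ij}}$, let $S=V(F)\subset\mathbf P^3_K$, and consider the fibration $S\dashrightarrow\mathbf P^1$, $(X_0:X_1:X_2:X_3)\mapsto(X_2:X_3)$, with coordinate $t=X_2/X_3$ on the base; its affine equation is $F(x,y,t,1)=m_1+m_2+m_3+tm_4$ with monomials $m_i$ in $x,y$. Let $\ell_1=V(X_2,X_3)$. For $i=1,\dots,4$ put $$N_i=X_0^{a_{i0}}X_1^{a_{i1}}X_2^{a_{i2}+a_{i3}-\varepsilon},\qquad \varepsilon=1\text{ if }\ell_1\subset S,\quad \varepsilon=0\text{ otherwise},$$ and $G=N_1+N_2+N_3+tN_4$. Assume that the generic fiber, i.e. the plane curve over $K(t)$ defined by $G$, is irreducible ($G$ is irreducible in $K(t)[X_0,X_1,X_2]$); the fibration is then called a minimal Delsarte fibration. Let $A'$ be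 the $4\times 3$ exponent matrix of $N_1,\dots,N_4$, and let $\mathbf k=(k_1,k_2,k_3,k_4)\in\mathbf Z^4$ be the unique vector with $\mathbf kA'=0$, $k_4>0$ and $\gcd(k_1,k_2,k_3,k_4)=1$. For $t_0\in K$, the fiber over $t_0$ is called singular if the fiber over $t_0$ of the normalization of the family of plane curves $\{G=0\}\subset\mathbf A^1_K\times\mathbf P^2_K$ is not smooth over $K$ (so singularities of the plane curves that can be resolved simultaneously in a neighborhood of $t_0$, with smooth fiber over $t_0$, do not count). Suppose that $t_0\in K$, $t_0\neq 0$, and that the fiber over $t_0$ is singular. Then $$t_0^{k_4}=\prod_{i:\,k_i\neq 0}k_i^{k_i},$$ or $N_i=N_j$ for some $i\neq j$. -/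

import Mathlib

noncomputable section

namespace Delsarte

open MvPolynomial

variable (K : Type*) [Field K]

/-- The Delsarte polynomial `F = ∑ i, ∏ j, X_j ^ (a i j)` with exponent matrix `A`
(all coefficients are `1`). -/
def poly (A : Matrix (Fin 4) (Fin 4) ℕ) : MvPolynomial (Fin 4) K :=
  ∑ i, ∏ j, X j ^ A i j

/-- The line `ℓ₁ = V(X₂, X₃)` is contained in the surface `S = V(F)`. -/
def ContainsLine (A : Matrix (Fin 4) (Fin 4) ℕ) : Prop :=
  ∀ p : Fin 4 → K, p 2 = 0 → p 3 = 0 → eval p (poly K A) = 0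

open Classical in
/-- The exponent matrix `A'` of the monomials `N₁, …, N₄` in `X₀, X₁, X₂`. The `i`-th monomial of `F`
evaluated at `(X₀, X₁, X₂, X₂)` has exponents `a i 0, a i 1, a i 2 + a i 3`; if `ℓ₁ ⊆ S`, then
all four of them are divisible by `X₂`, and one factor `X₂` is removed. -/
def pencilMatrix (A : Matrix (Fin 4) (Fin 4) ℕ) : Matrix (Fin 4) (Fin 3) ℕ :=
  fun i => ![A i 0, A i 1, if ContainsLine K A then A i 2 + A i 3 - 1 else A i 2 + A i 3]

/-- The monomial `N_i` (over a coefficient ring `R`). -/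
def pencilMonomial (A : Matrix (Fin 4) (Fin 4) ℕ) (R : Type*) [CommRing R] (i : Fin 4) :
    MvPolynomial (Fin 3) R :=
  ∏ j, X j ^ pencilMatrix K A i j

/-- `G = N₁ + N₂ + N₃ + t N₄`, a form in `X₀, X₁, X₂` with coefficients in `K[t]`. It defines the
family of plane curves in `𝔸¹ × ℙ²` that is the standard fibration outside `t = ∞`. -/
def pencil (A : Matrix (Fin 4) (Fin 4) ℕ) : MvPolynomial (Fin 3) (Polynomial K) :=
  pencilMonomial K A (Polynomial K) 0 + pencilMonomial K A (Polynomial K) 1 +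
    pencilMonomial K A (Polynomial K) 2 +
    C Polynomial.X * pencilMonomial K A (Polynomial K) 3

/-- The defining polynomial over `K(t)` of the generic fiber of the standard fibration. -/
def genericFiber (A : Matrix (Fin 4) (Fin 4) ℕ) : MvPolynomial (Fin 3) (RatFunc K) :=
  map (algebraMap (Polynomial K) (RatFunc K)) (pencil K A)

/-- The standard fibration `(X₀ : X₁ : X₂ : X₃) ↦ (X₂ : X₃)` on the Delsarte surface with exponent
matrix `A` is a minimal Delsarte fibration; the monomials are ordered so that `t` occurs in the
last one. -/
structure IsMinimalFibration (A : Matrix (Fin 4) (Fin 4) ℕ) : Prop where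
  /-- `F` is homogeneous -/
  homogeneous : ∃ d : ℕ, ∀ i, ∑ j, A i j = d
  /-- the affine equation `F(x, y, t, 1)` is `m₁ + m₂ + m₃ + t m₄`, with monomials `m_i` in `x, y` -/
  exponent_t : ∀ i, A i 2 = if i = 3 then 1 else 0
  /-- the exponent matrix is invertible -/
  det_ne_zero : (A.map (Nat.cast : ℕ → ℤ)).det ≠ 0
  /-- the generic fiber is an irreducible curve -/
  irreducible : Irreducible (genericFiber K A)

/-- The coordinate ring, over `K[t]`, of the affine chart `X_j = 1` of the family
`{G = 0} ⊆ 𝔸¹ × ℙ²`. -/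
abbrev ChartRing (A : Matrix (Fin 4) (Fin 4) ℕ) (j : Fin 3) : Type _ :=
  MvPolynomial (Fin 3) (Polynomial K) ⧸ Ideal.span {pencil K A, X j - 1}

/-- The coordinate ring of the normalization of this chart. -/
abbrev NormalizedChartRing (A : Matrix (Fin 4) (Fin 4) ℕ) (j : Fin 3) : Type _ :=
  integralClosure (ChartRing K A j) (FractionRing (ChartRing K A j))

/-- The coordinate ring of the fiber over `t = t₀` of the normalized chart. -/
abbrev FiberChartRing (A : Matrix (Fin 4) (Fin 4) ℕ) (t₀ : K) (j : Fin 3) : Type _ :=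
  NormalizedChartRing K A j ⧸
    Ideal.span {algebraMap (Polynomial K) (NormalizedChartRing K A j)
      (Polynomial.X - Polynomial.C t₀)}

/-- The fiber over `t = t₀` is singular. The plane curves `G(t, ·) = 0` may all be singular at the
base points of the pencil; a fiber is regarded as smooth if these singularities can be resolved
simultaneously near `t₀` with smooth fiber, that is, if the fiber over `t₀` of the normalization of
the family is smooth. This is checked on the three standard charts. -/
def SingularFiber (A : Matrix (Fin 4) (Fin 4) ℕ) (t₀ : K) : Prop :=
  ¬ ∀ j : Fin 3, Algebra.Smooth K (FiberChartRing K A t₀ j)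

/-- The normalized kernel vector: `k A' = 0`, `k₄ > 0` and the (integral) entries of `k` have
greatest common divisor `1`. -/
structure IsKernelVector (A : Matrix (Fin 4) (Fin 4) ℕ) (k : Fin 4 → ℤ) : Prop where
  vecMul_eq_zero : Matrix.vecMul k ((pencilMatrix K A).map (Nat.cast : ℕ → ℤ)) = 0
  pos : 0 < k 3
  gcd_eq_one : Finset.univ.gcd k = 1

end Delsarte

end

/-! Assume that the four monomials are distinct and that `t₀ ≠ 0` violates the equation for `t₀ ^ k
3`; it is shown that every chart of the fiber is smooth. On a chart, the total space has functions
`x`, `y`, `τ` with `n₀ + n₁ + n₂ + τ n₃ = 0`, where `n_l = x ^ α_l * y ^ β_l`. Irreducibility of `G`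
makes this chart integral (`ker_parametrize`), and its function field is `K(x, y)`, with `τ` a
rational function.

The main point is that the normalization `B` is locally toric. Let `P` be a prime of `B` containing
`τ - t₀`. If `x` or `y` lies in `P`, then for each valuation ring dominating `B_P` two of the four
terms have equal value, which yields a direction `(p, q)` with `v(x) ^ q = v(y) ^ p`
(`exists_direction`). This direction depends only on `P` (`not_lt_of_dominates`): two different ones
would let the equation be split into two parts, both in `P`, whose sum is a unit at `P`. Hence `w =
x ^ q * y ^ (-p)` is a unit at `P`, and `u = x ^ a * y ^ b` with `a p + b q = 1` is regular there
(`exists_chart`). Over `Q = K[w, w⁻¹][u]` the equation becomes `c φ + r = 0`, where `φ` is the image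
of `τ` and `c` is a monomial. The ring `R = Q[φ]` is integrally closed
(`mem_toricChart_of_isIntegral`), so `B ⊆ R ⊆ B_P`, and near `P` the fiber is a localization of `R /
(φ - t₀) = Q / (r + t₀ c)`.

It remains to see that this plane toric curve is smooth. At a singular point the four terms `z_l`
have sum zero and are also annihilated by both exponent vectors, so `z_l = a k_l`, because the space
of such relations is a line (`IsMinimalFibration.isRelationVector`). Forming `∏ z_l ^ k_l` cancels
`a`, `u` and `w` and leaves exactly the excluded equation for `t₀` (`IsRelationVector.prod_eq`). -/

noncomputable section

namespace Delsarte

open Polynomial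

/-! ### Formal smoothness of hypersurfaces and of localizations -/

section FormallySmooth

variable {R P : Type*} [CommRing R] [CommRing P] [Algebra R P]

/-- Jacobian criterion for a hypersurface: if some derivation maps the equation to `1` modulo
the equation, then the hypersurface in a formally smooth algebra is formally smooth. -/
theorem formallySmooth_quotient_of_derivation [Algebra.FormallySmooth R P] (r : P)
    (D : Derivation R P P) (hD : r ∣ D r - 1) :
    Algebra.FormallySmooth R (P ⧸ Ideal.span {r}) := by
  set f : P →ₐ[R] P ⧸ Ideal.span {r} := Ideal.Quotient.mkₐ R (Ideal.span {r}) with hf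
  have hker : RingHom.ker f.toRingHom = Ideal.span {r} := Ideal.mk_ker
  have hsq : ∀ a : P, r ^ 2 ∣ a → (Ideal.Quotient.mk (RingHom.ker f.toRingHom ^ 2)) a = 0 := by
    intro a ha
    rw [Ideal.Quotient.eq_zero_iff_mem, hker, Ideal.span_singleton_pow, Ideal.mem_span_singleton]
    exact ha
  -- The map `a ↦ a - r * D a` fails to be multiplicative only by `r ^ 2 * D a * D b`, and it sends
  -- `r` into `(r ^ 2)` because `D r ≡ 1` modulo `r`. It therefore splits `P / (r ^ 2) → P / (r)`.
  let g : P →ₐ[R] P ⧸ RingHom.ker f.toRingHom ^ 2 :=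
    AlgHom.ofLinearMap
      ((Ideal.Quotient.mkₐ R (RingHom.ker f.toRingHom ^ 2)).toLinearMap ∘ₗ
        (LinearMap.id - (LinearMap.mulLeft R r) ∘ₗ (D : P →ₗ[R] P)))
      (by
        change Ideal.Quotient.mk _ (1 - r * D 1) = 1
        rw [D.map_one_eq_zero, mul_zero, sub_zero, map_one])
      (by
        intro a b
        rw [← sub_eq_zero]
        simp only [LinearMap.coe_comp, Function.comp_apply, LinearMap.sub_apply,
          LinearMap.id_apply, AlgHom.toLinearMap_apply, Ideal.Quotient.mkₐ_eq_mk,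
          LinearMap.mulLeft_apply, Derivation.coeFn_coe, Derivation.leibniz, smul_eq_mul]
        rw [← map_mul, ← map_sub]
        exact hsq _ ⟨- (D a * D b), by ring⟩)
  have hgr : ∀ a ∈ Ideal.span {r}, g a = 0 := by
    intro a ha
    obtain ⟨b, rfl⟩ := Ideal.mem_span_singleton.mp ha
    obtain ⟨c, hc⟩ := hD
    rw [map_mul]
    have : g r = 0 := by
      refine hsq _ ⟨- c, ?_⟩
      simp only [LinearMap.sub_apply, LinearMap.id_apply, LinearMap.coe_comp,
        Function.comp_apply, LinearMap.mulLeft_apply, Derivation.coeFn_coe]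
      rw [eq_add_of_sub_eq hc]
      ring
    rw [this, zero_mul]
  refine Algebra.FormallySmooth.of_split f (Ideal.Quotient.liftₐ _ g hgr) ?_
  refine Ideal.Quotient.algHom_ext _ (AlgHom.ext fun a => ?_)
  change f (a - r * D a) = f a
  rw [map_sub, map_mul]
  have : f r = 0 := Ideal.Quotient.eq_zero_iff_mem.mpr (Ideal.mem_span_singleton_self r)
  rw [this, zero_mul, sub_zero]

/-- If `R` lies between a ring `B` and its localization at a prime containing `s`, and
`R / s` is formally smooth, then `B / s` is formally smooth at that prime. -/
theorem formallySmooth_localization_of_le {k B R : Type*} [CommRing k] [CommRing B] [CommRing R]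
    [Algebra k B] [Algebra k R] [Algebra B R] [IsScalarTower k B R] [IsDomain R]
    (hinj : Function.Injective (algebraMap B R)) (s : B) (p : Ideal (B ⧸ Ideal.span {s}))
    [p.IsPrime]
    (h : ∀ r : R, ∃ f b : B, Ideal.Quotient.mk _ f ∉ p ∧ algebraMap B R f * r = algebraMap B R b)
    [Algebra.FormallySmooth k (R ⧸ Ideal.span {algebraMap B R s})] :
    Algebra.FormallySmooth k (Localization.AtPrime p) := by
  set C := B ⧸ Ideal.span {s} with hC
  set D := R ⧸ Ideal.span {algebraMap B R s} with hD
  let φ : C →ₐ[k] D := Ideal.quotientMapₐ (Ideal.span {algebraMap B R s})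
    (IsScalarTower.toAlgHom k B R) (by
      rw [Ideal.span_singleton_le_iff_mem, Ideal.mem_comap]
      exact Ideal.mem_span_singleton_self _)
  have hφ : ∀ b : B, φ (Ideal.Quotient.mk _ b) = Ideal.Quotient.mk _ (algebraMap B R b) :=
    fun b => rfl
  let M : Submonoid D := p.primeCompl.map φ
  -- compare `C_p` and `D_M`
  let e : Localization.AtPrime p →ₐ[k] Localization M :=
    IsLocalization.liftAlgHom (M := p.primeCompl)
      (f := (IsScalarTower.toAlgHom k D (Localization M)).comp φ)
      (fun y => IsLocalization.map_units (Localization M) (⟨φ y, y, y.2, rfl⟩ : M))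
  have he : ∀ c : C, e (algebraMap C _ c) = algebraMap D _ (φ c) := fun c =>
    IsLocalization.lift_eq _ c
  have hkey : ∀ d : D, ∃ f : C, ∃ b : C, f ∉ p ∧ φ f * d = φ b := by
    intro d
    obtain ⟨r, rfl⟩ := Ideal.Quotient.mk_surjective d
    obtain ⟨f, b, hf, hfb⟩ := h r
    refine ⟨Ideal.Quotient.mk _ f, Ideal.Quotient.mk _ b, hf, ?_⟩
    rw [hφ, hφ, ← map_mul, hfb]
  -- If `b = s r` with `r` only in `R`, clearing the denominator of `r` puts a multiple of `b` by an
  -- element outside `p` into `s B`.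
  have hker : ∀ c : C, φ c = 0 → ∃ f : C, f ∉ p ∧ f * c = 0 := by
    intro c hc
    obtain ⟨b, rfl⟩ := Ideal.Quotient.mk_surjective c
    rw [hφ, Ideal.Quotient.eq_zero_iff_mem, Ideal.mem_span_singleton] at hc
    obtain ⟨r, hr⟩ := hc
    obtain ⟨f, b', hf, hfb⟩ := h r
    refine ⟨_, hf, ?_⟩
    rw [← map_mul, Ideal.Quotient.eq_zero_iff_mem, Ideal.mem_span_singleton]
    refine ⟨b', hinj ?_⟩
    rw [map_mul, map_mul, hr, ← hfb]
    ring
  have hbij : Function.Bijective e := by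
    constructor
    · rw [injective_iff_map_eq_zero]
      intro z hz
      obtain ⟨c, f, rfl⟩ := IsLocalization.exists_mk'_eq p.primeCompl z
      have h1 : e (algebraMap C _ c) = 0 := by
        rw [← IsLocalization.mk'_spec (Localization.AtPrime p) c f, map_mul, hz, zero_mul]
      rw [he, ← map_zero (algebraMap D (Localization M)),
        IsLocalization.eq_iff_exists M (Localization M)] at h1
      obtain ⟨⟨_, f₁, hf₁, rfl⟩, h2⟩ := h1
      have h2 : φ (f₁ * c) = 0 := by
        rw [map_mul]
        simpa using h2
      obtain ⟨f₂, hf₂, h3⟩ := hker _ h2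
      rw [IsLocalization.mk'_eq_zero_iff]
      exact ⟨⟨f₂ * f₁, p.primeCompl.mul_mem hf₂ hf₁⟩, by simpa [mul_assoc] using h3⟩
    · intro z
      obtain ⟨d, ⟨_, f, hf, rfl⟩, rfl⟩ := IsLocalization.exists_mk'_eq M z
      obtain ⟨g, b, hg, hgb⟩ := hkey d
      refine ⟨IsLocalization.mk' _ b (⟨g * f, p.primeCompl.mul_mem hg hf⟩ : p.primeCompl), ?_⟩
      rw [IsLocalization.eq_mk'_iff_mul_eq]
      have hu : IsUnit (e (algebraMap C _ g)) :=
        ((IsLocalization.map_units (Localization.AtPrime p)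
          (⟨g, hg⟩ : p.primeCompl))).map e
      refine hu.mul_left_cancel ?_
      change _ * (_ * algebraMap D _ (φ f)) = _
      have hspec := IsLocalization.mk'_spec (Localization.AtPrime p) b
        (⟨g * f, p.primeCompl.mul_mem hg hf⟩ : p.primeCompl)
      rw [← he f, mul_left_comm, ← map_mul, ← map_mul, ← map_mul, hspec, he, he, ← map_mul, hgb]
  have : Algebra.FormallySmooth D (Localization M) := .of_isLocalization M
  have : Algebra.FormallySmooth k (Localization M) := .comp k D _
  exact .of_equiv (AlgEquiv.ofBijective e hbij).symm

end FormallySmooth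

/-- A finitely generated domain over a field of characteristic zero has finite normalization. -/
theorem finite_integralClosure (k A L : Type*) [Field k] [CharZero k] [CommRing A] [IsDomain A]
    [Field L] [Algebra k A] [Algebra A L] [IsFractionRing A L] [Algebra.FiniteType k A] :
    Module.Finite A (integralClosure A L) := by
  -- Noether normalization makes `A` finite over a polynomial ring, which is integrally closed; in
  -- characteristic zero the extension of fraction fields is separable, so the integral closure is
  -- finite.
  obtain ⟨n, g, hg, hfin⟩ := exists_finite_inj_algHom_of_fg k A
  let _ : Algebra (MvPolynomial (Fin n) k) A := g.toRingHom.toAlgebra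
  have hgA : Module.Finite (MvPolynomial (Fin n) k) A := hfin
  let _ : Algebra (MvPolynomial (Fin n) k) L :=
    ((algebraMap A L).comp (algebraMap (MvPolynomial (Fin n) k) A)).toAlgebra
  have : IsScalarTower (MvPolynomial (Fin n) k) A L := .of_algebraMap_eq' rfl
  have hinj : Function.Injective (algebraMap (MvPolynomial (Fin n) k) L) :=
    (IsFractionRing.injective A L).comp hg
  have : FaithfulSMul (MvPolynomial (Fin n) k) L :=
    (faithfulSMul_iff_algebraMap_injective _ _).mpr hinj
  have : FaithfulSMul (MvPolynomial (Fin n) k) A :=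
    (faithfulSMul_iff_algebraMap_injective _ _).mpr hg
  let _ : Algebra (FractionRing (MvPolynomial (Fin n) k)) L := FractionRing.liftAlgebra _ _
  have : IsScalarTower (MvPolynomial (Fin n) k) (FractionRing (MvPolynomial (Fin n) k)) L :=
    FractionRing.isScalarTower_liftAlgebra _ _
  have : Module.Finite (FractionRing (MvPolynomial (Fin n) k)) L :=
    Module.Finite.of_isLocalization (MvPolynomial (Fin n) k) A
      (nonZeroDivisors (MvPolynomial (Fin n) k)) 
  have : CharZero (FractionRing (MvPolynomial (Fin n) k)) :=
    charZero_of_injective_algebraMap (R := k)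
      (FaithfulSMul.algebraMap_injective k (FractionRing (MvPolynomial (Fin n) k)))
  have : IsIntegralClosure (integralClosure A L) (MvPolynomial (Fin n) k) L :=
    { algebraMap_injective := Subtype.val_injective
      isIntegral_iff := fun {z} => by
        refine ⟨fun hz => ⟨⟨z, hz.tower_top⟩, rfl⟩, ?_⟩
        rintro ⟨z, rfl⟩
        have : Algebra.IsIntegral (MvPolynomial (Fin n) k) A := Algebra.IsIntegral.of_finite _ _
        exact isIntegral_trans (R := MvPolynomial (Fin n) k) (A := A) _ z.2 }
  have := IsIntegralClosure.finite (MvPolynomial (Fin n) k)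
    (FractionRing (MvPolynomial (Fin n) k)) L (integralClosure A L)
  exact Module.Finite.of_restrictScalars_finite (MvPolynomial (Fin n) k) A _

end Delsarte

end

noncomputable section

namespace Delsarte

open Polynomial

/-! ### Monomials and logarithmic derivations on `𝔾ₘ × 𝔸¹` -/

section Toric

variable (K : Type*) [Field K]

/-- The coordinate ring `K[w, w⁻¹][u]` of `𝔾ₘ × 𝔸¹`. -/
abbrev ToricRing : Type _ := (LaurentPolynomial K)[X]

instance laurent_ufd : UniqueFactorizationMonoid (LaurentPolynomial K) :=
  UniqueFactorizationMonoid.of_isLocalization (Submonoid.powers (X : K[X])) _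

instance laurent_formallySmooth : Algebra.FormallySmooth K (LaurentPolynomial K) := by
  have : IsScalarTower K K[X] (LaurentPolynomial K) :=
    .of_algebraMap_eq fun r => by
      rw [LaurentPolynomial.algebraMap_eq_toLaurent, Polynomial.algebraMap_eq,
        Polynomial.toLaurent_C, LaurentPolynomial.C_eq_algebraMap]
  have : Algebra.FormallySmooth K[X] (LaurentPolynomial K) :=
    .of_isLocalization (Submonoid.powers (X : K[X]))
  exact .comp K K[X] _

instance toricRing_formallySmooth : Algebra.FormallySmooth K (ToricRing K) :=
  .comp K (LaurentPolynomial K) _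

instance toricRing_finiteType : Algebra.FiniteType K (ToricRing K) :=
  .trans (S := LaurentPolynomial K) inferInstance inferInstance

variable {K}

/-- The monomial `u ^ e * w ^ f`. -/
def toricMonomial (e : ℕ) (f : ℤ) : ToricRing K := C (LaurentPolynomial.T f) * X ^ e

theorem isUnit_toricMonomial_zero (f : ℤ) : IsUnit (toricMonomial (K := K) 0 f) := by
  simpa [toricMonomial] using (LaurentPolynomial.isUnit_T (R := K) f).map (C : _ →+* ToricRing K)

/-- The linear map `w ^ n ↦ n w ^ n` on Laurent polynomials. -/
def laurentWeight : LaurentPolynomial K →ₗ[K] LaurentPolynomial K :=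
  (AddMonoidAlgebra.coeffLinearEquiv K).symm.toLinearMap ∘ₗ
    (Finsupp.lsum K fun n : ℤ => (n : K) • Finsupp.lsingle n) ∘ₗ
    (AddMonoidAlgebra.coeffLinearEquiv K).toLinearMap

theorem laurentWeight_C_mul_T (a : K) (n : ℤ) :
    laurentWeight (LaurentPolynomial.C a * LaurentPolynomial.T n) =
      (n : K) • (LaurentPolynomial.C a * LaurentPolynomial.T n) := by
  rw [← LaurentPolynomial.single_eq_C_mul_T, ← AddMonoidAlgebra.ofCoeff_single]
  change AddMonoidAlgebra.ofCoeff
    (Finsupp.lsum K (fun n : ℤ => (n : K) • Finsupp.lsingle n) (Finsupp.single n a)) = _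
  rw [Finsupp.lsum_single]
  rfl

/-- The derivation `w ∂/∂w` of the ring of Laurent polynomials. -/
def laurentDerivation : Derivation K (LaurentPolynomial K) (LaurentPolynomial K) :=
  Derivation.mk' laurentWeight (by
    intro a b
    induction a using LaurentPolynomial.induction_on' with
    | add p q hp hq => simp only [add_mul, map_add, hp, hq, smul_eq_mul, mul_add]; ring
    | C_mul_T n a =>
      induction b using LaurentPolynomial.induction_on' with
      | add p q hp hq => simp only [mul_add, map_add, hp, hq, smul_eq_mul, add_mul]; ring
      | C_mul_T m b =>
        have h : LaurentPolynomial.C a * LaurentPolynomial.T n *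
            (LaurentPolynomial.C b * LaurentPolynomial.T m) =
            LaurentPolynomial.C (a * b) * LaurentPolynomial.T (n + m) := by
          rw [map_mul, LaurentPolynomial.T_add]; ring
        rw [h, laurentWeight_C_mul_T, laurentWeight_C_mul_T, laurentWeight_C_mul_T, ← h]
        simp only [Int.cast_add, add_smul, smul_eq_mul, mul_smul_comm]
        rw [add_comm, mul_comm (LaurentPolynomial.C b * LaurentPolynomial.T m)])

theorem laurentDerivation_T (n : ℤ) :
    laurentDerivation (LaurentPolynomial.T n : LaurentPolynomial K) =
      (n : K) • LaurentPolynomial.T n := by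
  have := laurentWeight_C_mul_T (1 : K) n
  rwa [map_one, one_mul] at this

/-- The derivation `w ∂/∂w` of `K[w, w⁻¹][u]`. -/
def toricDerivationW : Derivation K (ToricRing K) (ToricRing K) :=
  ((PolynomialModule.equivPolynomialSelf (R := LaurentPolynomial K)).toLinearMap).compDer
    (laurentDerivation (K := K)).mapCoeffs

/-- The derivation `u ∂/∂u` of `K[w, w⁻¹][u]`. -/
def toricDerivationU : Derivation K (ToricRing K) (ToricRing K) :=
  (X : ToricRing K) • (Polynomial.derivative' (R := LaurentPolynomial K)).restrictScalars K

theorem toricDerivationW_monomial (e : ℕ) (f : ℤ) :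
    toricDerivationW (toricMonomial (K := K) e f) = (f : K) • toricMonomial e f := by
  rw [toricMonomial, C_mul_X_pow_eq_monomial]
  change PolynomialModule.equivPolynomialSelf
    ((laurentDerivation (K := K)).mapCoeffs (monomial e (LaurentPolynomial.T f))) = _
  rw [Derivation.mapCoeffs_monomial, laurentDerivation_T]
  ext n : 1
  rw [PolynomialModule.equivPolynomialSelf_apply_eq, PolynomialModule.equivPolynomial_single,
    smul_monomial]

theorem toricDerivationU_monomial (e : ℕ) (f : ℤ) :
    toricDerivationU (toricMonomial (K := K) e f) = (e : K) • toricMonomial e f := by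
  change X * derivative (toricMonomial (K := K) e f) = _
  rw [toricMonomial, derivative_C_mul_X_pow]
  rcases e with _ | e
  · simp
  · rw [Nat.add_sub_cancel, map_mul, Nat.cast_smul_eq_nsmul, nsmul_eq_mul, pow_succ]
    simp only [map_natCast]
    ring

theorem laurent_algHom_T {L : Type*} [Field L] [Algebra K L] (g : LaurentPolynomial K →ₐ[K] L)
    (n : ℤ) : g (LaurentPolynomial.T n) = g (LaurentPolynomial.T 1) ^ n := by
  have h : ∀ m : ℕ, g (LaurentPolynomial.T m) = g (LaurentPolynomial.T 1) ^ m := fun m => by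
    rw [← map_pow, LaurentPolynomial.T_pow, mul_one]
  rcases n with m | m
  · rw [Int.ofNat_eq_natCast, zpow_natCast, h m]
  · have h1 : g (LaurentPolynomial.T (Int.negSucc m)) * g (LaurentPolynomial.T ((m + 1 : ℕ))) = 1 := by
      rw [← map_mul, ← LaurentPolynomial.T_add, Int.negSucc_eq]
      simp
    rw [zpow_negSucc, ← h (m + 1)]
    exact eq_inv_of_mul_eq_one_left h1

theorem laurent_algHom_T_ne_zero {L : Type*} [Field L] [Algebra K L]
    (g : LaurentPolynomial K →ₐ[K] L) (n : ℤ) : g (LaurentPolynomial.T n) ≠ 0 :=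
  ((LaurentPolynomial.isUnit_T n).map g).ne_zero

/-- The inclusion of `K[w, w⁻¹]` into `K[w, w⁻¹][u]`. -/
def laurentInclusion : LaurentPolynomial K →ₐ[K] ToricRing K :=
  (CAlgHom (R := LaurentPolynomial K) (A := LaurentPolynomial K)).restrictScalars K

theorem toric_algHom_monomial {L : Type*} [Field L] [Algebra K L] (g : ToricRing K →ₐ[K] L)
    (e : ℕ) (f : ℤ) :
    g (toricMonomial e f) = g X ^ e * g (C (LaurentPolynomial.T 1)) ^ f := by
  rw [toricMonomial, map_mul, map_pow, mul_comm]
  congr 1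
  exact laurent_algHom_T (g.comp laurentInclusion) f

end Toric

/-! ### Smoothness of the four-term toric curve -/

section Nullstellensatz

/-- Weak Nullstellensatz for finitely generated algebras. -/
theorem exists_algHom_of_ne_top {K Q : Type*} [Field K] [IsAlgClosed K] [CommRing Q] [Algebra K Q]
    [Algebra.FiniteType K Q] (I : Ideal Q) (hI : I ≠ ⊤) :
    ∃ f : Q →ₐ[K] K, ∀ a ∈ I, f a = 0 := by
  obtain ⟨M, hM, hIM⟩ := I.exists_le_maximal hI
  let _ := Ideal.Quotient.field M
  have : Module.Finite K (Q ⧸ M) := finite_of_finite_type_of_isJacobsonRing K (Q ⧸ M)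
  have hb := IsAlgClosed.algebraMap_bijective_of_isIntegral (k := K) (K := Q ⧸ M)
  let e := AlgEquiv.ofBijective (Algebra.ofId K (Q ⧸ M)) hb
  refine ⟨e.symm.toAlgHom.comp (Ideal.Quotient.mkₐ K M), fun a ha => ?_⟩
  have : Ideal.Quotient.mk M a = 0 := Ideal.Quotient.eq_zero_iff_mem.mpr (hIM ha)
  simp [this]

variable {K : Type*} [Field K]

/-- The sum `∑ l, c l * u ^ (e l) * w ^ (f l)`. -/
def toricPoly (c : Fin 4 → K) (e : Fin 4 → ℕ) (f : Fin 4 → ℤ) : ToricRing K :=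
  ∑ l, c l • toricMonomial (e l) (f l)

/-- The relations among the four exponent vectors `(1, e l, f l)` are spanned by `k`. -/
structure IsRelationVector (K : Type*) [Field K] (e : Fin 4 → ℤ) (f : Fin 4 → ℤ)
    (k : Fin 4 → ℤ) : Prop where
  sum_eq_zero : ∑ l, k l = 0
  sum_fst : ∑ l, e l * k l = 0
  sum_snd : ∑ l, f l * k l = 0
  last_ne_zero : k 3 ≠ 0
  unique : ∀ z : Fin 4 → K, ∑ l, z l = 0 → ∑ l, (e l : K) * z l = 0 → ∑ l, (f l : K) * z l = 0 →
    ∃ a : K, ∀ l, z l = a * k l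

/-- The three vanishing sums make the vector of terms a multiple `a k`. Raising the `l`-th term to
the power `k l` and multiplying removes `a`, `u` and `w`, since `k` is orthogonal to `(1, 1, 1, 1)`,
`e` and `f`; only the coefficient `t` survives on one side and the entries of `k` on the other. -/
theorem IsRelationVector.prod_eq [CharZero K] {e : Fin 4 → ℕ} {f k : Fin 4 → ℤ}
    (hk : IsRelationVector K (fun l => (e l : ℤ)) f k) {t u w : K} (ht : t ≠ 0) (hw : w ≠ 0)
    (he : ∃ l, e l = 0)
    (h0 : ∑ l, ![1, 1, 1, t] l * (u ^ e l * w ^ f l) = 0)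
    (h1 : ∑ l, (e l : K) * (![1, 1, 1, t] l * (u ^ e l * w ^ f l)) = 0)
    (h2 : ∑ l, (f l : K) * (![1, 1, 1, t] l * (u ^ e l * w ^ f l)) = 0) :
    t ^ k 3 = ∏ i with k i ≠ 0, (k i : K) ^ k i := by
  have hc : ∀ l, (![1, 1, 1, t] : Fin 4 → K) l ≠ 0 := by
    intro l; fin_cases l <;> simp [ht]
  obtain ⟨a, ha⟩ := hk.unique _ h0 (by simpa using h1) h2
  -- A term with `e l = 0` does not vanish, even at a point with `u = 0`.
  have ha0 : a ≠ 0 := by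
    rintro rfl
    obtain ⟨l, hl⟩ := he
    have := ha l
    rw [zero_mul, hl, pow_zero, one_mul] at this
    exact mul_ne_zero (hc l) (zpow_ne_zero _ hw) this
  have hS : ∀ g : Fin 4 → ℤ, ∑ l, g l * k l = 0 → ∑ l with k l ≠ 0, g l * k l = 0 := by
    intro g hg
    rw [Finset.sum_filter]
    refine Eq.trans ?_ hg
    refine Finset.sum_congr rfl fun l _ => ?_
    split_ifs with h
    · rfl
    · rw [not_not.mp h, mul_zero]
  have hzpow : ∀ (v : K) (hv : v ≠ 0) (g : Fin 4 → ℤ), ∑ l, g l * k l = 0 →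
      ∏ l with k l ≠ 0, (v ^ g l) ^ k l = 1 := by
    intro v hv g hg
    simp_rw [← zpow_mul]
    have : ∀ s : Finset (Fin 4), ∏ l ∈ s, v ^ (g l * k l) = v ^ ∑ l ∈ s, g l * k l := by
      intro s
      induction s using Finset.induction_on with
      | empty => simp
      | insert i s hi ih => rw [Finset.prod_insert hi, Finset.sum_insert hi, zpow_add₀ hv, ih]
    rw [this, hS g hg, zpow_zero]
  have hu : ∏ l with k l ≠ 0, (u ^ e l) ^ k l = 1 := by
    -- At `u = 0` a term with `e l > 0` vanishes, which forces `k l = 0`, so it does not occur in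
    -- the product.
    by_cases hu : u = 0
    · refine Finset.prod_eq_one fun l hl => ?_
      have hkl : (k l : K) ≠ 0 := by exact_mod_cast (Finset.mem_filter.mp hl).2
      have h3 : u ^ e l ≠ 0 := fun h3 => by
        have := ha l
        rw [h3, zero_mul, mul_zero] at this
        exact mul_ne_zero ha0 hkl this.symm
      have : e l = 0 := by
        by_contra h4
        rw [hu, zero_pow h4] at h3
        exact h3 rfl
      rw [this, pow_zero, one_zpow]
    · simpa using hzpow u hu (fun l => (e l : ℤ)) hk.sum_fst
  have hc1 : ∏ l with k l ≠ 0, (![1, 1, 1, t] : Fin 4 → K) l ^ k l = t ^ k 3 := by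
    rw [Finset.prod_filter, Fin.prod_univ_four]
    simp [hk.last_ne_zero]
  have hl : ∏ l with k l ≠ 0, (![1, 1, 1, t] l * (u ^ e l * w ^ f l)) ^ k l = t ^ k 3 := by
    simp_rw [mul_zpow, Finset.prod_mul_distrib]
    rw [hc1, hu, hzpow w hw f hk.sum_snd, mul_one, mul_one]
  rw [← hl]
  simp_rw [ha, mul_zpow, Finset.prod_mul_distrib]
  have := hzpow a ha0 (fun _ => 1) (by simpa using hk.sum_eq_zero)
  simp only [zpow_one] at this
  rw [this, one_mul]

theorem toricPoly_algHom {L : Type*} [Field L] [Algebra K L] (g : ToricRing K →ₐ[K] L)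
    (c : Fin 4 → K) (e : Fin 4 → ℕ) (f : Fin 4 → ℤ) :
    g (toricPoly c e f) =
      ∑ l, algebraMap K L (c l) * (g X ^ e l * g (C (LaurentPolynomial.T 1)) ^ f l) := by
  rw [toricPoly, map_sum]
  refine Finset.sum_congr rfl fun l _ => ?_
  rw [map_smul, toric_algHom_monomial, Algebra.smul_def]

theorem toricDerivationU_toricPoly (c : Fin 4 → K) (e : Fin 4 → ℕ) (f : Fin 4 → ℤ) :
    toricDerivationU (toricPoly c e f) = toricPoly (fun l => e l * c l) e f := by
  simp only [toricPoly, map_sum, Derivation.map_smul, toricDerivationU_monomial, smul_smul]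
  simp only [mul_comm]

theorem toricDerivationW_toricPoly (c : Fin 4 → K) (e : Fin 4 → ℕ) (f : Fin 4 → ℤ) :
    toricDerivationW (toricPoly c e f) = toricPoly (fun l => f l * c l) e f := by
  simp only [toricPoly, map_sum, Derivation.map_smul, toricDerivationW_monomial, smul_smul]
  simp only [mul_comm]

/-- The curve `u ^ e₀ w ^ f₀ + u ^ e₁ w ^ f₁ + u ^ e₂ w ^ f₂ + t u ^ e₃ w ^ f₃ = 0` is smooth
unless `t` is the critical value of the relation vector. -/
theorem formallySmooth_toricPoly [IsAlgClosed K] [CharZero K] {e : Fin 4 → ℕ} {f k : Fin 4 → ℤ}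
    (hk : IsRelationVector K (fun l => (e l : ℤ)) f k) {t : K} (ht : t ≠ 0)
    (he : ∃ l, e l = 0) (hne : t ^ k 3 ≠ ∏ i with k i ≠ 0, (k i : K) ^ k i) :
    Algebra.FormallySmooth K (ToricRing K ⧸ Ideal.span {toricPoly ![1, 1, 1, t] e f}) := by
  set r := toricPoly ![1, 1, 1, t] e f with hr
  -- The logarithmic derivative `u ∂/∂u` is a multiple of `∂/∂u`, so this is stronger than the
  -- Jacobian criterion along `u = 0`. It is the form that turns a common zero into linear relations
  -- among the four terms.
  have htop : Ideal.span {r, toricDerivationU r, toricDerivationW r} = ⊤ := by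
    by_contra h
    obtain ⟨g, hg⟩ := exists_algHom_of_ne_top (K := K) _ h
    have h0 := hg r (Ideal.subset_span (by simp))
    have h1 := hg (toricDerivationU r) (Ideal.subset_span (by simp))
    have h2 := hg (toricDerivationW r) (Ideal.subset_span (by simp))
    rw [hr, toricPoly_algHom] at h0
    rw [hr, toricDerivationU_toricPoly, toricPoly_algHom] at h1
    rw [hr, toricDerivationW_toricPoly, toricPoly_algHom] at h2
    simp only [Algebra.algebraMap_self, RingHom.id_apply, mul_assoc] at h0 h1 h2
    exact hne (hk.prod_eq ht
      (laurent_algHom_T_ne_zero (g.comp laurentInclusion) 1) he h0 h1 h2)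
  have h1 : (1 : ToricRing K) ∈ Ideal.span {r, toricDerivationU r, toricDerivationW r} :=
    htop ▸ Submodule.mem_top
  rw [Ideal.mem_span_insert] at h1
  obtain ⟨a, z, hz, h1⟩ := h1
  obtain ⟨b, c, rfl⟩ := Ideal.mem_span_pair.mp hz
  refine formallySmooth_quotient_of_derivation r (b • toricDerivationU + c • toricDerivationW)
    ⟨- a, ?_⟩
  simp only [Derivation.add_apply, Derivation.smul_apply, smul_eq_mul]
  linear_combination -h1

end Nullstellensatz

end Delsarte

end

noncomputable section

namespace Delsarte

open Polynomial

/-! ### The ring `Q[φ]` for `c φ + r = 0`: relations, fibers, normality -/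

section LinearEquation

variable {Q L : Type*} [CommRing Q] [Field L] [Algebra Q L]

/-- If `c` and `r` are coprime, the kernel of evaluation at `- r / c` is generated by `c X + r`. -/
theorem dvd_of_aeval_eq_zero (hinj : Function.Injective (algebraMap Q L)) {c r : Q} {φ : L}
    (hc : c ≠ 0) (hφ : algebraMap Q L c * φ + algebraMap Q L r = 0)
    (hcop : ∀ z, c ∣ r * z → c ∣ z) (p : Q[X]) (hp : aeval φ p = 0) :
    C c * X + C r ∣ p := by
  have hcL : algebraMap Q L c ≠ 0 := by rwa [Ne, map_eq_zero_iff _ hinj]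
  have hpow : ∀ (n : ℕ) (z : Q), c ∣ r ^ n * z → c ∣ z := by
    intro n
    induction n with
    | zero => intro z h; simpa using h
    | succ n ih => intro z h; exact ih z (hcop _ (by rwa [← mul_assoc, ← pow_succ']))
  induction hn : p.natDegree using Nat.strong_induction_on generalizing p with
  | _ n ih =>
    rcases Nat.eq_zero_or_pos n with h0 | h0
    · rw [h0] at hn
      obtain ⟨a, rfl⟩ := natDegree_eq_zero.mp hn
      rw [aeval_C, map_eq_zero_iff _ hinj] at hp
      rw [hp, map_zero]
      exact dvd_zero _
    · -- the leading coefficient is divisible by `c`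
      have hlead : c ∣ p.leadingCoeff := by
        refine hpow n _ ?_
        -- In `c ^ n * p(φ)`, written through `c φ = - r`, every term except the one with `i = n` is
        -- divisible by `c`.
        have hE : algebraMap Q L (∑ i ∈ Finset.range (n + 1), p.coeff i * (- r) ^ i * c ^ (n - i)) =
            algebraMap Q L c ^ n * aeval φ p := by
          rw [aeval_eq_sum_range, hn, Finset.mul_sum, map_sum]
          refine Finset.sum_congr rfl fun i hi => ?_
          have hi' : i ≤ n := Nat.lt_succ_iff.mp (Finset.mem_range.mp hi)
          rw [Algebra.smul_def, map_mul, map_mul, map_pow, map_pow, map_neg,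
            ← eq_neg_of_add_eq_zero_left hφ, mul_pow]
          rw [← Nat.sub_add_cancel hi', pow_add]
          simp only [Nat.add_sub_cancel]
          ring
        rw [hp, mul_zero, map_eq_zero_iff _ hinj, Finset.sum_range_succ, Nat.sub_self, pow_zero,
          mul_one] at hE
        have h1 : c ∣ ∑ i ∈ Finset.range n, p.coeff i * (- r) ^ i * c ^ (n - i) := by
          refine Finset.dvd_sum fun i hi => Dvd.dvd.mul_left (dvd_pow_self c ?_) _
          have := Finset.mem_range.mp hi
          omega
        have h2 : c ∣ p.coeff n * (- r) ^ n := by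
          rw [eq_neg_of_add_eq_zero_right hE]
          exact h1.neg_right
        rw [leadingCoeff, hn]
        rcases neg_one_pow_eq_or Q n with h | h
        · rw [neg_pow, h, one_mul, mul_comm] at h2
          exact h2
        · rw [neg_pow, h, neg_one_mul, mul_neg, dvd_neg, mul_comm] at h2
          exact h2
      obtain ⟨d, hd⟩ := hlead
      set q : Q[X] := C d * X ^ (n - 1) with hq
      have hlin : aeval φ (C c * X + C r) = 0 := by simpa using hφ
      have hsub : aeval φ (p - (C c * X + C r) * q) = 0 := by
        rw [map_sub, map_mul, hlin, hp, zero_mul, sub_zero]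
      have hdeg : (p - (C c * X + C r) * q).natDegree < n := by
        have hexp : (C c * X + C r) * q = C (c * d) * X ^ n + C (r * d) * X ^ (n - 1) := by
          rw [hq]
          obtain ⟨m, rfl⟩ := Nat.exists_eq_succ_of_ne_zero h0.ne'
          simp only [Nat.succ_eq_add_one, Nat.add_sub_cancel, map_mul, pow_succ]
          ring
        rw [hexp, Nat.lt_iff_le_pred h0, natDegree_le_iff_coeff_eq_zero]
        intro N hN
        rw [coeff_sub, coeff_add, coeff_C_mul_X_pow, coeff_C_mul_X_pow]
        have hNn : N ≠ n - 1 := by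
          have : n.pred = n - 1 := rfl
          omega
        rcases eq_or_ne N n with rfl | hN'
        · have : p.coeff N = c * d := by rw [← hd, leadingCoeff, hn]
          simp [hNn, this]
        · have : p.coeff N = 0 := by
            refine coeff_eq_zero_of_natDegree_lt ?_
            have : n.pred = n - 1 := rfl
            omega
          simp [hNn, hN', this]
      obtain ⟨s, hs⟩ := ih _ hdeg _ hsub rfl
      exact ⟨s + q, by rw [mul_add, ← hs]; ring⟩

variable (Q) in
/-- The ring `Q[φ]`. -/
abbrev Adjoined (φ : L) : Subalgebra Q L := Algebra.adjoin Q {φ}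

theorem mem_adjoined_iff {φ z : L} : z ∈ Adjoined Q φ ↔ ∃ p : Q[X], aeval φ p = z := by
  rw [Adjoined, Algebra.adjoin_singleton_eq_range_aeval]
  rfl

theorem self_mem_adjoined (φ : L) : φ ∈ Adjoined Q φ := Algebra.self_mem_adjoin_singleton Q φ

/-- All relations of `φ` over `Q` are multiples of `c X + r`, so putting `φ = t` gives `Q[φ] / (φ -
t) ≃ Q / (r + t c)`. -/
theorem formallySmooth_adjoined {K : Type*} [Field K] [Algebra K Q] [Algebra K L]
    [IsScalarTower K Q L]
    (hinj : Function.Injective (algebraMap Q L)) {c r : Q} {φ : L}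
    (hc : c ≠ 0) (hφ : algebraMap Q L c * φ + algebraMap Q L r = 0)
    (hcop : ∀ z, c ∣ r * z → c ∣ z) (t : K)
    [Algebra.FormallySmooth K (Q ⧸ Ideal.span {r + t • c})] :
    Algebra.FormallySmooth K (Adjoined Q φ ⧸
      Ideal.span {(⟨φ, self_mem_adjoined φ⟩ : Adjoined Q φ) - algebraMap K (Adjoined Q φ) t}) := by
  set R := Adjoined Q φ
  set Φ : R := ⟨φ, self_mem_adjoined φ⟩
  set I := Ideal.span {Φ - algebraMap K R t}
  let g : Q →ₐ[K] R ⧸ I := (Ideal.Quotient.mkₐ K I).comp (IsScalarTower.toAlgHom K Q R)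
  have hg : ∀ a, g a = Ideal.Quotient.mk I (algebraMap Q R a) := fun a => rfl
  have hΦ : Ideal.Quotient.mk I Φ = Ideal.Quotient.mk I (algebraMap Q R (algebraMap K Q t)) := by
    rw [Ideal.Quotient.eq, ← IsScalarTower.algebraMap_apply]
    exact Ideal.mem_span_singleton_self _
  have haev : ∀ p : Q[X], Ideal.Quotient.mk I (aeval Φ p) = g (p.eval (algebraMap K Q t)) := by
    intro p
    induction p using Polynomial.induction_on' with
    | add p q hp hq => rw [map_add, map_add, hp, hq, eval_add, map_add]
    | monomial n a =>
      rw [aeval_monomial, eval_monomial, map_mul, map_pow, hΦ, hg, map_mul, map_pow, map_mul,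
        map_pow]
  have hval : ∀ p : Q[X], ((aeval Φ p : R) : L) = aeval φ p := fun p => by
    rw [← Subalgebra.coe_val, ← aeval_algHom_apply]; rfl
  have hsurj : Function.Surjective g := by
    intro z
    obtain ⟨⟨z, hz⟩, rfl⟩ := Ideal.Quotient.mk_surjective z
    obtain ⟨p, rfl⟩ := mem_adjoined_iff.mp hz
    exact ⟨_, by rw [← haev]; congr 1; exact Subtype.ext (hval p)⟩
  have hker : RingHom.ker g = Ideal.span {r + t • c} := by
    ext a
    rw [RingHom.mem_ker, hg, Ideal.Quotient.eq_zero_iff_mem, Ideal.mem_span_singleton,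
      Ideal.mem_span_singleton]
    constructor
    · rintro ⟨⟨z, hz⟩, h⟩
      obtain ⟨p, rfl⟩ := mem_adjoined_iff.mp hz
      have h' : aeval φ (C a - (X - C (algebraMap K Q t)) * p) = 0 := by
        have := congrArg Subtype.val h
        rw [map_sub, map_mul, map_sub, aeval_C, aeval_C, aeval_X, sub_eq_zero,
          ← IsScalarTower.algebraMap_apply]
        exact this
      obtain ⟨s, hs⟩ := dvd_of_aeval_eq_zero hinj hc hφ hcop _ h'
      refine ⟨s.eval (algebraMap K Q t), ?_⟩
      have := congrArg (eval (algebraMap K Q t)) hs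
      simp only [eval_sub, eval_mul, eval_C, eval_X, sub_self, zero_mul, sub_zero, eval_add] at this
      rw [this, Algebra.smul_def]
      ring
    · rintro ⟨b, rfl⟩
      refine ⟨- algebraMap Q R (c * b), Subtype.ext ?_⟩
      change algebraMap Q L ((r + t • c) * b) = (φ - algebraMap K L t) * - algebraMap Q L (c * b)
      rw [Algebra.smul_def, map_mul, map_add, map_mul, map_mul, ← IsScalarTower.algebraMap_apply]
      linear_combination (algebraMap Q L b) * hφ
  exact .of_equiv ((Ideal.quotientEquivAlgOfEq K hker.symm).trans
    (Ideal.quotientKerAlgEquivOfSurjective hsurj))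

/-- Coefficients of a nilpotent polynomial are nilpotent, and `Q ⧸ I` is reduced. -/
theorem isRadical_map_C {I : Ideal Q} (hI : I.IsRadical) : (I.map (C : Q →+* Q[X])).IsRadical := by
  rintro p ⟨n, hn⟩
  have hzero : ∀ q : Q[X], q.map (Ideal.Quotient.mk I) = 0 ↔ q ∈ I.map (C : Q →+* Q[X]) := by
    intro q
    rw [Ideal.mem_map_C_iff, Polynomial.ext_iff]
    simp [coeff_map, Ideal.Quotient.eq_zero_iff_mem]
  have : IsReduced (Q ⧸ I) := (Ideal.isRadical_iff_quotient_reduced I).mp hI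
  rw [← hzero] at hn ⊢
  rw [Polynomial.map_pow] at hn
  ext i
  have := Polynomial.isNilpotent_iff.mp ⟨n, hn⟩ i
  rw [coeff_zero]
  exact this.eq_zero

/-- Serre-type criterion: `Q[φ]`, `φ = - r / c`, is integrally closed if it is so away from a
divisor of `c` and reduced modulo that divisor. -/
theorem mem_adjoined_of_isIntegral [IsDomain Q] [IsIntegrallyClosed Q] [IsFractionRing Q L] {c r u : Q} {φ : L}
    (hc : c ≠ 0) (hφ : algebraMap Q L c * φ + algebraMap Q L r = 0)
    (hcop : ∀ z, c ∣ r * z → c ∣ z) (hu0 : u ≠ 0) (huc : u ∣ c) {N : ℕ} (hcu : c ∣ u ^ N)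
    (hrad : (Ideal.span {u, r}).IsRadical) {b : L} (hb : IsIntegral (Adjoined Q φ) b) :
    b ∈ Adjoined Q φ := by
  have hinj : Function.Injective (algebraMap Q L) := IsFractionRing.injective Q L
  set R := Adjoined Q φ with hR
  have huL : algebraMap Q L u ≠ 0 := by rwa [Ne, map_eq_zero_iff _ hinj]
  have hcL : algebraMap Q L c ≠ 0 := by rwa [Ne, map_eq_zero_iff _ hinj]
  -- descent
  have hdesc : ∀ b : L, IsIntegral R b → algebraMap Q L u * b ∈ R → b ∈ R := by
    intro b hb hub
    obtain ⟨p, hp, hpb⟩ := hb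
    set ur : R := algebraMap Q R u
    set a : R := ⟨algebraMap Q L u * b, hub⟩ with ha
    -- The scaled polynomial is a monic equation for `u b` whose lower coefficients are divisible by
    -- `u`; hence `(u b) ^ n` lies in `u R`.
    have hroot : (scaleRoots p ur).IsRoot a := by
      have h1 := scaleRoots_eval₂_eq_zero (s := ur) (algebraMap R L) hpb
      have h2 : algebraMap R L ur * b = algebraMap R L a := rfl
      rw [h2, eval₂_at_apply] at h1
      exact Subtype.ext h1
    have hmem := (scaleRoots.isWeaklyEisensteinAt p
      (Ideal.mem_span_singleton_self ur)).pow_natDegree_le_of_root_of_monic_mem hroot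
      ((monic_scaleRoots_iff ur).mpr hp) _ le_rfl
    obtain ⟨⟨h, hh⟩, hah⟩ := Ideal.mem_span_singleton.mp hmem
    obtain ⟨g, hg⟩ := mem_adjoined_iff.mp hub
    obtain ⟨g', rfl⟩ := mem_adjoined_iff.mp hh
    set n := (scaleRoots p ur).natDegree
    have hah' : (algebraMap Q L u * b) ^ n = algebraMap Q L u * aeval φ g' :=
      congrArg Subtype.val hah
    have hker : aeval φ (g ^ n - C u * g') = 0 := by
      rw [map_sub, map_pow, map_mul, aeval_C, hg, hah', sub_self]
    obtain ⟨s, hs⟩ := dvd_of_aeval_eq_zero hinj hc hφ hcop _ hker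
    obtain ⟨c', rfl⟩ := huc
    -- As `u` divides `c`, the relation `c X + r` lies in the ideal generated by `u` and `r`, so
    -- radicality passes from `g ^ n` to `g`.
    have hgn : g ^ n ∈ (Ideal.span {u, r}).map (C : Q →+* Q[X]) := by
      rw [Ideal.map_span, Set.image_pair, Ideal.mem_span_pair]
      refine ⟨g' + C c' * X * s, s, ?_⟩
      rw [eq_add_of_sub_eq hs, map_mul]
      ring
    have hg1 := isRadical_map_C hrad ⟨n, hgn⟩
    rw [Ideal.map_span, Set.image_pair, Ideal.mem_span_pair] at hg1
    obtain ⟨g₁, g₂, hg12⟩ := hg1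
    -- In `u b = u g₁(φ) + r g₂(φ)` replace `r` by `- c φ = - u c' φ` and cancel `u`.
    have hfin : b = aeval φ g₁ - algebraMap Q L c' * φ * aeval φ g₂ := by
      refine mul_left_cancel₀ huL ?_
      rw [← hg, ← hg12, map_add, map_mul, map_mul, aeval_C, aeval_C]
      rw [map_mul] at hφ
      linear_combination (aeval φ g₂) * hφ
    rw [hfin]
    refine mem_adjoined_iff.mpr ⟨g₁ - C c' * X * g₂, ?_⟩
    simp
  have hdescN : ∀ (n : ℕ) (b : L), IsIntegral R b → algebraMap Q L u ^ n * b ∈ R → b ∈ R := by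
    intro n
    induction n with
    | zero => intro b _ h; simpa using h
    | succ n ih =>
      intro b hb h
      refine hdesc b hb (ih _ ?_ (by rwa [← mul_assoc, ← pow_succ]))
      exact IsIntegral.mul (isIntegral_algebraMap (R := R) (x := algebraMap Q R u)) hb
  -- clearing denominators
  let M := Submonoid.powers u
  have hM : M ≤ nonZeroDivisors Q := powers_le_nonZeroDivisors_of_noZeroDivisors hu0
  let ι : Localization M →ₐ[Q] L := IsLocalization.liftAlgHom (M := M) (f := Algebra.ofId Q L)
    (by
      rintro ⟨_, m, rfl⟩
      simpa [Algebra.ofId_apply] using pow_ne_zero m huL)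
  have hιinj : Function.Injective ι :=
    (IsLocalization.lift_injective_iff _).mpr fun x y => by
      rw [(IsLocalization.injective (Localization M) hM).eq_iff]
      exact hinj.eq_iff.symm
  have hle : R ≤ ι.range := by
    refine Algebra.adjoin_le (Set.singleton_subset_iff.mpr ?_)
    obtain ⟨d, hd⟩ := hcu
    refine ⟨IsLocalization.mk' _ (- r * d) (⟨u ^ N, N, rfl⟩ : M), ?_⟩
    refine (IsLocalization.lift_mk'_spec _ _ _ _).mpr ?_
    change algebraMap Q L (- r * d) = algebraMap Q L (u ^ N) * φ
    rw [hd, map_mul, map_mul, map_neg]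
    linear_combination (-algebraMap Q L d) * hφ
  let _ : Algebra (Localization M) L := ι.toRingHom.toAlgebra
  have : IsScalarTower Q (Localization M) L := .of_algebraMap_eq fun x => (ι.commutes x).symm
  let ρ : R →+* Localization M :=
    ((AlgEquiv.ofInjective ι hιinj).symm.toAlgHom.comp (Subalgebra.inclusion hle)).toRingHom
  have hρ : ∀ x : R, ι (ρ x) = x := fun x => by
    have := (AlgEquiv.ofInjective ι hιinj).apply_symm_apply (Subalgebra.inclusion hle x)
    exact congrArg Subtype.val this
  -- After inverting `u` the ring `Q[φ]` lies in `Q[1/u]`. Hence some `u ^ n * b` is integral over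
  -- `Q`, so it lies in `Q`, and the descent removes the factors `u` one at a time.
  have hb' : IsIntegral (Localization M) b := by
    obtain ⟨p, hp, hpb⟩ := hb
    refine ⟨p.map ρ, hp.map ρ, ?_⟩
    rw [eval₂_map]
    have : (algebraMap (Localization M) L).comp ρ = algebraMap R L := RingHom.ext hρ
    rw [this]
    exact hpb
  obtain ⟨⟨_, n, rfl⟩, hn⟩ := hb'.exists_multiple_integral_of_isLocalization M b
  obtain ⟨z, hz⟩ := IsIntegrallyClosed.isIntegral_iff.mp hn
  refine hdescN n b hb ?_
  have : algebraMap Q L u ^ n * b = algebraMap Q L z := by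
    rw [hz, Submonoid.smul_def, Algebra.smul_def, map_pow]
  rw [this]
  exact R.algebraMap_mem z

variable (K Q : Type*) [Field K] [CommRing Q] {L : Type*} [Field L] [Algebra K Q] [Algebra K L]
  [Algebra Q L] [IsScalarTower K Q L]

/-- The ring `Q[φ]`, as a `K`-algebra. -/
def chart (φ : L) : Subalgebra K L := (Adjoined Q φ).restrictScalars K

variable {K Q}

theorem self_mem_chart (φ : L) : φ ∈ chart K Q φ := self_mem_adjoined φ

theorem algebraMap_mem_chart (φ : L) (a : Q) : algebraMap Q L a ∈ chart K Q φ :=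
  (Adjoined Q φ).algebraMap_mem a

theorem chart_induction {φ : L} {p : L → Prop} (hφ : p φ) (hQ : ∀ a : Q, p (algebraMap Q L a))
    (hadd : ∀ x y, p x → p y → p (x + y)) (hmul : ∀ x y, p x → p y → p (x * y)) {z : L}
    (hz : z ∈ chart K Q φ) : p z := by
  refine Algebra.adjoin_induction (p := fun x _ => p x) ?_ hQ (fun x y _ _ => hadd x y)
    (fun x y _ _ => hmul x y) (show z ∈ Adjoined Q φ from hz)
  rintro x rfl
  exact hφ

theorem formallySmooth_chart (hinj : Function.Injective (algebraMap Q L)) {c r : Q} {φ : L}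
    (hc : c ≠ 0) (hφ : algebraMap Q L c * φ + algebraMap Q L r = 0)
    (hcop : ∀ z, c ∣ r * z → c ∣ z) (t : K)
    (h : Algebra.FormallySmooth K (Q ⧸ Ideal.span {r + t • c})) :
    Algebra.FormallySmooth K (chart K Q φ ⧸
      Ideal.span {(⟨φ, self_mem_chart φ⟩ : chart K Q φ) - algebraMap K (chart K Q φ) t}) :=
  formallySmooth_adjoined hinj hc hφ hcop t

theorem mem_chart_of_isIntegral [IsDomain Q] [IsIntegrallyClosed Q] [IsFractionRing Q L]
    {c r u : Q} {φ : L}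
    (hc : c ≠ 0) (hφ : algebraMap Q L c * φ + algebraMap Q L r = 0)
    (hcop : ∀ z, c ∣ r * z → c ∣ z) (hu0 : u ≠ 0) (huc : u ∣ c) {N : ℕ} (hcu : c ∣ u ^ N)
    (hrad : (Ideal.span {u, r}).IsRadical) {b : L} (hb : IsIntegral (chart K Q φ) b) :
    b ∈ chart K Q φ :=
  mem_adjoined_of_isIntegral hc hφ hcop hu0 huc hcu hrad hb

end LinearEquation

end Delsarte

end

noncomputable section

namespace Delsarte

open Polynomial

/-! ### Normality and smooth fibers of the toric charts -/

section ToricChart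

variable {K : Type*} [Field K]

theorem coeff_zero_toricPoly (c : Fin 4 → K) (e : Fin 4 → ℕ) (f : Fin 4 → ℤ) :
    (toricPoly c e f).coeff 0 =
      ∑ l, (if e l = 0 then c l else 0) • (LaurentPolynomial.T (f l) : LaurentPolynomial K) := by
  rw [toricPoly, finsetSum_coeff]
  refine Finset.sum_congr rfl fun l _ => ?_
  rw [coeff_smul, toricMonomial, coeff_C_mul_X_pow]
  rcases eq_or_ne (e l) 0 with h | h
  · simp [h]
  · simp [h, h.symm]

theorem toricMonomial_ne_zero (m : ℕ) (n : ℤ) : toricMonomial (K := K) m n ≠ 0 :=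
  mul_ne_zero (C_ne_zero.mpr (LaurentPolynomial.isUnit_T n).ne_zero) (pow_ne_zero _ X_ne_zero)

/-- If `x ^ 2` divides `a`, then `x` divides both `a` and `D a`, hence is a unit; squarefree
elements of a factorial ring are radical. -/
theorem isRadical_of_derivation {A : Type*} [CommRing A] [IsDomain A] [UniqueFactorizationMonoid A]
    [Algebra K A] (D : Derivation K A A) {a : A} (ha : Ideal.span {a, D a} = ⊤) : IsRadical a := by
  have hsq : Squarefree a := by
    rintro x ⟨m, rfl⟩
    rw [← Ideal.span_singleton_eq_top, eq_top_iff, ← ha, Ideal.span_le]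
    rintro z (rfl | rfl)
    · exact Ideal.mem_span_singleton.mpr ⟨x * m, by ring⟩
    · refine Ideal.mem_span_singleton.mpr ⟨x * D m + m * D x + m * D x, ?_⟩
      simp only [Derivation.leibniz, smul_eq_mul]
      ring
  exact hsq.isRadical

variable [IsAlgClosed K] [CharZero K]

/-- At a common zero, the terms with `e l = 0`, extended by zero, satisfy all three relations and
form a multiple of `k`. Their last entry is zero while `k 3 ≠ 0`, so all of them vanish; but powers
of `w` do not vanish. Thus the restriction of `r` to `u = 0` has only simple roots. -/
theorem span_coeff_zero_eq_top {e : Fin 4 → ℕ} {f k : Fin 4 → ℤ}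
    (hk : IsRelationVector K (fun l => (e l : ℤ)) f k) (he : ∃ l, e l = 0) (he3 : e 3 ≠ 0) :
    Ideal.span {(toricPoly (K := K) ![1, 1, 1, 0] e f).coeff 0,
      laurentDerivation ((toricPoly (K := K) ![1, 1, 1, 0] e f).coeff 0)} = ⊤ := by
  by_contra h
  obtain ⟨g, hg⟩ := exists_algHom_of_ne_top (K := K) _ h
  have h0 := hg _ (Ideal.subset_span (Set.mem_insert _ _))
  have h1 := hg _ (Ideal.subset_span (Set.mem_insert_of_mem _ rfl))
  simp only [coeff_zero_toricPoly, map_sum, Derivation.map_smul, map_smul,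
    laurentDerivation_T] at h0 h1
  obtain ⟨a, ha⟩ := hk.unique
    (fun l => (if e l = 0 then (![1, 1, 1, 0] : Fin 4 → K) l else 0) •
      g (LaurentPolynomial.T (f l))) h0
    (Finset.sum_eq_zero fun l _ => by
      rcases eq_or_ne (e l) 0 with h | h <;> simp [h])
    (by
      refine Eq.trans (Finset.sum_congr rfl fun l _ => ?_) h1
      simp only [smul_eq_mul]
      ring)
  have ha0 : a = 0 := by
    have := ha 3
    rw [if_neg he3, zero_smul] at this
    exact (mul_eq_zero.mp this.symm).resolve_right (by exact_mod_cast hk.last_ne_zero)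
  obtain ⟨l, hl⟩ := he
  have hl3 : l ≠ 3 := by rintro rfl; exact he3 hl
  have := ha l
  rw [if_pos hl, ha0, zero_mul, smul_eq_zero] at this
  refine this.elim (fun h => ?_) (laurent_algHom_T_ne_zero g _)
  revert h hl3
  fin_cases l <;> simp

/-- Modulo `u`, only the constant coefficient of `r` matters, and it is squarefree by
`span_coeff_zero_eq_top`. This is the reducedness needed for normality along `u = 0`. -/
theorem isRadical_span_toricPoly {e : Fin 4 → ℕ} {f k : Fin 4 → ℤ}
    (hk : IsRelationVector K (fun l => (e l : ℤ)) f k) (he : ∃ l, e l = 0) (he3 : e 3 ≠ 0) :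
    (Ideal.span {(X : ToricRing K), toricPoly ![1, 1, 1, 0] e f}).IsRadical := by
  have hrad := isRadical_of_derivation _ (span_coeff_zero_eq_top hk he he3)
  set r := toricPoly (K := K) ![1, 1, 1, 0] e f
  have hmem : ∀ a : ToricRing K, a ∈ Ideal.span {X, r} ↔ r.coeff 0 ∣ a.coeff 0 := by
    intro a
    rw [Ideal.mem_span_pair]
    constructor
    · rintro ⟨b, c, rfl⟩
      rw [coeff_add, mul_coeff_zero, mul_coeff_zero, coeff_X_zero, mul_zero, zero_add]
      exact dvd_mul_left _ _
    · rintro ⟨d, hd⟩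
      have h1 : X ∣ a - C d * r := by
        rw [X_dvd_iff, coeff_sub, coeff_C_mul, hd]
        ring
      obtain ⟨b, hb⟩ := h1
      exact ⟨b, C d, by linear_combination -hb⟩
  rintro a ⟨n, hn⟩
  rw [hmem, coeff_zero_eq_eval_zero (a ^ n), eval_pow, ← coeff_zero_eq_eval_zero] at hn
  exact (hmem a).mpr (hrad n _ hn)

variable {L : Type*} [Field L] [Algebra K L] [Algebra (ToricRing K) L]
  [IsScalarTower K (ToricRing K) L] [IsFractionRing (ToricRing K) L]
  {e : Fin 4 → ℕ} {f k : Fin 4 → ℤ} {φ : L}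

/-- The denominator is a unit times a power of the prime `u`. If that power is positive, `u` does
not divide `r`, whose constant coefficient is nonzero by `span_coeff_zero_eq_top`. -/
theorem toricMonomial_dvd_of_dvd_mul (hk : IsRelationVector K (fun l => (e l : ℤ)) f k)
    (he : ∃ l, e l = 0) (z : ToricRing K)
    (hz : toricMonomial (e 3) (f 3) ∣ toricPoly ![1, 1, 1, 0] e f * z) :
    toricMonomial (e 3) (f 3) ∣ z := by
  have hassoc : Associated (X ^ e 3 : ToricRing K) (toricMonomial (e 3) (f 3)) := by
    rw [toricMonomial]
    exact associated_unit_mul_right _ _ ((LaurentPolynomial.isUnit_T (f 3)).map C)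
  rw [← hassoc.dvd_iff_dvd_left] at hz ⊢
  rcases eq_or_ne (e 3) 0 with h3 | h3
  · rw [h3, pow_zero]
    exact one_dvd _
  · refine prime_X.pow_dvd_of_dvd_mul_left _ (fun h => ?_) hz
    rw [X_dvd_iff] at h
    have := span_coeff_zero_eq_top hk he h3
    rw [h, map_zero] at this
    simp at this

theorem formallySmooth_toricChart (hk : IsRelationVector K (fun l => (e l : ℤ)) f k)
    (he : ∃ l, e l = 0) {t : K} (ht : t ≠ 0)
    (hne : t ^ k 3 ≠ ∏ i with k i ≠ 0, (k i : K) ^ k i)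
    (hφ : algebraMap (ToricRing K) L (toricMonomial (e 3) (f 3)) * φ +
      algebraMap (ToricRing K) L (toricPoly ![1, 1, 1, 0] e f) = 0) :
    Algebra.FormallySmooth K (chart K (ToricRing K) φ ⧸
      Ideal.span {(⟨φ, self_mem_chart φ⟩ : chart K (ToricRing K) φ) -
        algebraMap K (chart K (ToricRing K) φ) t}) := by
  have hr : toricPoly ![1, 1, 1, 0] e f + t • toricMonomial (e 3) (f 3) =
      toricPoly ![1, 1, 1, t] e f := by
    simp [toricPoly, Fin.sum_univ_four]
  have : Algebra.FormallySmooth K (ToricRing K ⧸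
      Ideal.span {toricPoly ![1, 1, 1, 0] e f + t • toricMonomial (e 3) (f 3)}) := by
    rw [hr]
    exact formallySmooth_toricPoly hk ht he hne
  exact formallySmooth_chart (IsFractionRing.injective _ L) (toricMonomial_ne_zero _ _) hφ
    (toricMonomial_dvd_of_dvd_mul hk he) t this

theorem mem_toricChart_of_isIntegral (hk : IsRelationVector K (fun l => (e l : ℤ)) f k)
    (he : ∃ l, e l = 0)
    (hφ : algebraMap (ToricRing K) L (toricMonomial (e 3) (f 3)) * φ +
      algebraMap (ToricRing K) L (toricPoly ![1, 1, 1, 0] e f) = 0) {b : L}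
    (hb : IsIntegral (chart K (ToricRing K) φ) b) : b ∈ chart K (ToricRing K) φ := by
  have hcop := toricMonomial_dvd_of_dvd_mul hk he
  have h0 := toricMonomial_ne_zero (K := K) (e 3) (f 3)
  -- For `e 3 = 0` the denominator is already a unit and the trivial divisor `1` serves in the
  -- criterion; otherwise normality can only fail along `u = 0`.
  rcases eq_or_ne (e 3) 0 with h3 | h3
  · refine mem_chart_of_isIntegral (u := 1) (N := 0) h0 hφ hcop one_ne_zero (one_dvd _) ?_ ?_ hb
    · rw [pow_zero, h3]
      exact (isUnit_toricMonomial_zero _).dvd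
    · have : Ideal.span {(1 : ToricRing K), toricPoly ![1, 1, 1, 0] e f} = ⊤ :=
        Ideal.eq_top_of_unit_mem _ 1 1 (Ideal.subset_span (Set.mem_insert _ _)) (mul_one _)
      rw [this]
      exact fun _ _ => Submodule.mem_top
  · refine mem_chart_of_isIntegral (u := X) (N := e 3) h0 hφ hcop X_ne_zero ?_ ?_
      (isRadical_span_toricPoly hk he h3) hb
    · exact (dvd_pow_self X h3).mul_left _
    · rw [toricMonomial]
      exact ((((LaurentPolynomial.isUnit_T (f 3)).map C).mul_left_dvd).mpr dvd_rfl)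

end ToricChart

end Delsarte

end

noncomputable section

namespace Delsarte

open Polynomial

/-! ### Unimodular coordinates on the torus -/

section Coordinates

variable {K L : Type*} [Field K] [Field L] [Algebra K L]

/-- A finite relation among Laurent monomials becomes polynomial after multiplication by a high
power of `x y`. -/
theorem linearIndependent_laurentMonomial {x y : L} (hx : x ≠ 0) (hy : y ≠ 0)
    (h : AlgebraicIndependent K ![x, y]) :
    LinearIndependent K (fun m : ℤ × ℤ => x ^ m.1 * y ^ m.2) := by
  have hnat : LinearIndependent K (fun m : Fin 2 →₀ ℕ => x ^ m 0 * y ^ m 1) := by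
    have h1 := (MvPolynomial.basisMonomials (Fin 2) K).linearIndependent.map'
      (MvPolynomial.aeval ![x, y] : MvPolynomial (Fin 2) K →ₐ[K] L).toLinearMap
      (LinearMap.ker_eq_bot.mpr h)
    have h2 : (fun m : Fin 2 →₀ ℕ => x ^ m 0 * y ^ m 1) =
        (MvPolynomial.aeval ![x, y] : MvPolynomial (Fin 2) K →ₐ[K] L).toLinearMap ∘
          MvPolynomial.basisMonomials (Fin 2) K := by
      ext m
      simp [MvPolynomial.aeval_monomial, Finsupp.prod_fintype, Fin.prod_univ_two]
    rw [h2]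
    exact h1
  rw [linearIndependent_iff']
  intro s g hg
  obtain ⟨N, hN⟩ : ∃ N : ℕ, ∀ m ∈ s, -(N : ℤ) ≤ m.1 ∧ -(N : ℤ) ≤ m.2 := by
    refine ⟨s.sup fun m => m.1.natAbs + m.2.natAbs, fun m hm => ?_⟩
    have := Finset.le_sup (f := fun m : ℤ × ℤ => m.1.natAbs + m.2.natAbs) hm
    omega
  let τ : ℤ × ℤ → (Fin 2 →₀ ℕ) := fun m =>
    Finsupp.equivFunOnFinite.symm ![(m.1 + N).toNat, (m.2 + N).toNat]
  have hτ0 : ∀ m, τ m 0 = (m.1 + N).toNat := fun m => rfl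
  have hτ1 : ∀ m, τ m 1 = (m.2 + N).toNat := fun m => rfl
  have hτ : Set.InjOn τ s := by
    intro m hm m' hm' hmm
    have h0 := DFunLike.congr_fun hmm 0
    have h1 := DFunLike.congr_fun hmm 1
    rw [hτ0, hτ0] at h0
    rw [hτ1, hτ1] at h1
    have := hN m hm
    have := hN m' hm'
    ext <;> omega
  have hinj := hnat.comp (fun m : s => τ m) (fun m m' hmm => Subtype.ext (hτ m.2 m'.2 hmm))
  rw [Fintype.linearIndependent_iff] at hinj
  intro m hm
  refine hinj (fun m => g m) ?_ ⟨m, hm⟩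
  have : ∀ m : s, g m • (((fun m : Fin 2 →₀ ℕ => x ^ m 0 * y ^ m 1) ∘ fun m : s => τ m) m) =
      (x ^ N * y ^ N) * (g m • (x ^ m.1.1 * y ^ m.1.2)) := by
    intro m
    have h1 := hN m m.2
    simp only [Function.comp_apply, hτ0, hτ1]
    rw [← zpow_natCast x, ← zpow_natCast y, Int.toNat_of_nonneg (by omega),
      Int.toNat_of_nonneg (by omega), zpow_add₀ hx, zpow_add₀ hy, zpow_natCast, zpow_natCast,
      mul_smul_comm]
    congr 1
    ring
  rw [Finset.sum_congr rfl fun m _ => this m, ← Finset.mul_sum,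
    Finset.sum_coe_sort s fun m => g m • (x ^ m.1 * y ^ m.2), hg, mul_zero]

/-- The homomorphism `K[w, w⁻¹][u] → L` given by elements `u` and `w ≠ 0` of `L`. -/
def toricMap (u : L) (w : Lˣ) : ToricRing K →ₐ[K] L :=
  Polynomial.aevalTower (AddMonoidAlgebra.lift K L ℤ
    ((Units.coeHom L).comp (zpowersHom Lˣ w))) u

theorem toricMap_monomial (u : L) (w : Lˣ) (e : ℕ) (f : ℤ) :
    toricMap (K := K) u w (toricMonomial e f) = u ^ e * (w : L) ^ f := by
  rw [toric_algHom_monomial]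
  congr 2
  · exact aevalTower_X _ _
  · rw [toricMap, aevalTower_C, LaurentPolynomial.T, AddMonoidAlgebra.lift_single]
    simp

theorem span_range_toricMonomial :
    Submodule.span K (Set.range fun m : ℕ × ℤ => toricMonomial (K := K) m.1 m.2) = ⊤ := by
  rw [eq_top_iff]
  rintro p -
  induction p using Polynomial.induction_on' with
  | add p q hp hq => exact add_mem hp hq
  | monomial n a =>
    induction a using LaurentPolynomial.induction_on' with
    | add p q hp hq => rw [map_add]; exact add_mem hp hq
    | C_mul_T m a =>
      rw [← LaurentPolynomial.smul_eq_C_mul, ← smul_monomial, ← C_mul_X_pow_eq_monomial]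
      exact Submodule.smul_mem _ _ (Submodule.subset_span ⟨(n, m), rfl⟩)

theorem toricMap_injective {u : L} {w : Lˣ}
    (h : LinearIndependent K (fun m : ℕ × ℤ => u ^ m.1 * (w : L) ^ m.2)) :
    Function.Injective (toricMap (K := K) u w) := by
  rw [injective_iff_map_eq_zero]
  intro q hq
  have hmem : q ∈ Submodule.span K (Set.range fun m : ℕ × ℤ => toricMonomial (K := K) m.1 m.2) :=
    span_range_toricMonomial (K := K) ▸ Submodule.mem_top
  obtain ⟨c, rfl⟩ := (Finsupp.mem_span_range_iff_exists_finsupp).mp hmem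
  rw [map_finsuppSum] at hq
  simp only [map_smul, toricMap_monomial] at hq
  have := linearIndependent_iff.mp h c hq
  rw [this, Finsupp.sum_zero_index]

/-- Unimodular change of coordinates on the torus. -/
theorem isFractionRing_toricMap {x y : L} (hx : x ≠ 0) (hy : y ≠ 0)
    (h : AlgebraicIndependent K ![x, y]) (hgen : IntermediateField.adjoin K {x, y} = ⊤)
    {p q a b : ℤ} (hdet : a * p + b * q = 1) {u : L} {w : Lˣ} (hu : u = x ^ a * y ^ b)
    (hw : (w : L) = x ^ q * y ^ (-p)) :
    letI := (toricMap (K := K) u w).toRingHom.toAlgebra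
    IsFractionRing (ToricRing K) L := by
  have hu0 : u ≠ 0 := by rw [hu]; positivity
  have hLI : LinearIndependent K (fun m : ℕ × ℤ => u ^ m.1 * (w : L) ^ m.2) := by
    have h1 := (linearIndependent_laurentMonomial hx hy h).comp
      (fun m : ℕ × ℤ => (a * m.1 + q * m.2, b * m.1 - p * m.2)) ?_
    · convert h1 using 1
      ext m
      simp only [Function.comp_apply]
      rw [hu, hw, mul_pow, mul_zpow, zpow_add₀ hx, sub_eq_add_neg, zpow_add₀ hy, ← neg_mul, zpow_mul,
        zpow_mul, zpow_mul, zpow_mul, zpow_natCast, zpow_natCast]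
      ring
    · rintro ⟨i, j⟩ ⟨i', j'⟩ hij
      simp only [Prod.mk.injEq] at hij ⊢
      obtain ⟨h1, h2⟩ := hij
      constructor
      · have : (i : ℤ) = i' := by linear_combination p * h1 + q * h2 + (i' - i) * hdet
        exact_mod_cast this
      · linear_combination b * h1 - a * h2 + (j' - j) * hdet
  have hinj := toricMap_injective hLI
  let _ := (toricMap (K := K) u w).toRingHom.toAlgebra
  have hgen' : IntermediateField.adjoin K (Set.range ![u, (w : L)]) = ⊤ := by
    rw [eq_top_iff, ← hgen, IntermediateField.adjoin_le_iff]
    have hum : u ∈ IntermediateField.adjoin K (Set.range ![u, (w : L)]) :=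
      IntermediateField.subset_adjoin _ _ ⟨0, rfl⟩
    have hwm : (w : L) ∈ IntermediateField.adjoin K (Set.range ![u, (w : L)]) :=
      IntermediateField.subset_adjoin _ _ ⟨1, rfl⟩
    rintro z (rfl | rfl)
    -- The exponent matrix with rows `(a, b)` and `(q, -p)` has determinant `-1`; its inverse gives
    -- `x = u ^ p * w ^ b` and `y = u ^ q * w ^ (-a)`.
    · have : z = u ^ p * (w : L) ^ b := by
        rw [hu, hw, mul_zpow, mul_zpow, ← zpow_mul, ← zpow_mul, ← zpow_mul, ← zpow_mul,
          mul_mul_mul_comm, ← zpow_add₀ hx, ← zpow_add₀ hy]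
        rw [show a * p + q * b = 1 by linarith, show b * p + -p * b = 0 by ring]
        simp
      rw [this]
      exact mul_mem (zpow_mem hum _) (zpow_mem hwm _)
    · have : z = u ^ q * (w : L) ^ (-a) := by
        rw [hu, hw, mul_zpow, mul_zpow, ← zpow_mul, ← zpow_mul, ← zpow_mul, ← zpow_mul,
          mul_mul_mul_comm, ← zpow_add₀ hx, ← zpow_add₀ hy]
        rw [show a * q + q * -a = 0 by ring, show b * q + -p * -a = 1 by linarith]
        simp
      rw [this]
      exact mul_mem (zpow_mem hum _) (zpow_mem hwm _)
  have : FaithfulSMul (ToricRing K) L := (faithfulSMul_iff_algebraMap_injective _ _).mpr hinj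
  refine IsFractionRing.of_field _ _ fun z => ?_
  have hz : z ∈ IntermediateField.adjoin K (Set.range ![u, (w : L)]) :=
    hgen' ▸ IntermediateField.mem_top
  obtain ⟨r, s, rfl⟩ := (IntermediateField.mem_adjoin_range_iff _ _ _).mp hz
  have hcomp : ∀ r : MvPolynomial (Fin 2) K, MvPolynomial.aeval ![u, (w : L)] r =
      toricMap (K := K) u w
        (MvPolynomial.aeval ![toricMonomial 1 0, toricMonomial 0 1] r) := by
    intro r
    rw [← AlgHom.comp_apply, MvPolynomial.comp_aeval]
    congr 2
    ext i
    fin_cases i <;> simp [toricMap_monomial]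
  exact ⟨_, _, by rw [hcomp, hcomp]; rfl⟩

end Coordinates

end Delsarte

end

noncomputable section

namespace Delsarte

/-! ### Valuation rings dominating a local ring -/

section Dominating

variable {L : Type*} [Field L] {B : Subring L} {P : Ideal B}

/-- The valuation ring `V` dominates the localization of `B` at `P`. -/
structure Dominates (V : ValuationSubring L) (P : Ideal B) : Prop where
  le : B ≤ V.toSubring
  lt_one_iff : ∀ b : B, V.valuation b < 1 ↔ b ∈ P

/-- The element `z` lies in the localization of `B` at `P`. -/
def IsLocalAt (P : Ideal B) (z : L) : Prop := ∃ f : B, f ∉ P ∧ ∃ b : B, (f : L) * z = b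

theorem Dominates.valuation_le_one {V : ValuationSubring L} (h : Dominates V P) {z : L}
    (hz : z ∈ B) : V.valuation z ≤ 1 :=
  (V.valuation_le_one_iff z).mpr (h.le hz)

theorem Dominates.valuation_eq_one {V : ValuationSubring L} (h : Dominates V P) {b : B}
    (hb : b ∉ P) : V.valuation b = 1 :=
  le_antisymm (h.valuation_le_one b.2) (not_lt.mp fun h' => hb ((h.lt_one_iff b).mp h'))

variable [hP : P.IsPrime]

theorem dominates_of_le {V : ValuationSubring L}
    (h : LocalSubring.ofPrime B P ≤ V.toLocalSubring) : Dominates V P := by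
  obtain ⟨hle, hloc⟩ := h
  have hB : B ≤ V.toSubring := (LocalSubring.le_ofPrime B P).trans hle
  refine ⟨hB, fun b => ?_⟩
  have h1 : IsUnit (algebraMap B (LocalSubring.ofPrime B P).toSubring b) ↔ b ∈ P.primeCompl :=
    IsLocalization.AtPrime.isUnit_to_map_iff _ P b
  have h2 : IsUnit (algebraMap B (LocalSubring.ofPrime B P).toSubring b) ↔
      IsUnit (⟨b, hB b.2⟩ : V) := by
    constructor
    · intro hu
      exact hu.map (Subring.inclusion hle)
    · intro hu
      exact hloc.map_nonunit _ hu
  rw [← not_iff_not, ← not_iff_not.mpr (V.valuation_lt_one_iff ⟨b, hB b.2⟩)]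
  rw [IsLocalRing.mem_maximalIdeal, mem_nonunits_iff, not_not, ← h2, h1]
  rfl

theorem exists_dominates (P : Ideal B) [P.IsPrime] : ∃ V : ValuationSubring L, Dominates V P := by
  obtain ⟨V, hV⟩ := (LocalSubring.ofPrime B P).exists_le_valuationSubring
  exact ⟨V, dominates_of_le hV⟩

/-- The localization of an integrally closed ring is integrally closed, and an integrally closed
local ring is the intersection of the valuation rings dominating it. -/
theorem isLocalAt_of_forall_dominates [IsIntegrallyClosedIn B L] {z : L}
    (h : ∀ V : ValuationSubring L, Dominates V P → z ∈ V) : IsLocalAt P z := by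
  have hmem : ∀ y : L, y ∈ (LocalSubring.ofPrime B P).toSubring ↔ IsLocalAt P y := by
    intro y
    constructor
    · intro hy
      obtain ⟨⟨b, f⟩, hbf⟩ := IsLocalization.surj P.primeCompl
        (⟨y, hy⟩ : (LocalSubring.ofPrime B P).toSubring)
      refine ⟨f, f.2, b, ?_⟩
      have := congrArg Subtype.val hbf
      rw [mul_comm]
      exact this
    · rintro ⟨f, hf, b, hfb⟩
      have hu : IsUnit (algebraMap B (LocalSubring.ofPrime B P).toSubring f) :=
        (IsLocalization.AtPrime.isUnit_to_map_iff _ P f).mpr hf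
      obtain ⟨g, hg⟩ := isUnit_iff_exists_inv.mp hu
      have hg' : (f : L) * g = 1 := congrArg Subtype.val hg
      have : y = g * (algebraMap B (LocalSubring.ofPrime B P).toSubring b :
          (LocalSubring.ofPrime B P).toSubring) := by
        change y = g * (b : L)
        rw [← hfb]
        linear_combination (- y) * hg'
      rw [this]
      exact mul_mem g.2 (Subtype.property _)
  have : IsIntegrallyClosedIn (LocalSubring.ofPrime B P).toSubring L := by
    rw [Subring.isIntegrallyClosedIn_iff]
    intro y hy
    obtain ⟨m, hm⟩ := hy.exists_multiple_integral_of_isLocalization P.primeCompl y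
    obtain ⟨b, hb⟩ := IsIntegrallyClosedIn.isIntegral_iff.mp hm
    rw [hmem]
    exact ⟨m, m.2, b, hb.symm⟩
  by_contra hz
  rw [← hmem] at hz
  obtain ⟨V, hV, hzV⟩ := LocalSubring.exists_le_valuationSubring_of_isIntegrallyClosedIn hz
  exact hzV (h V (dominates_of_le hV))

end Dominating

/-! ### Inequalities between monomials in an ordered value group -/

section OrderedGroup

variable {Γ : Type*} [LinearOrderedCommGroupWithZero Γ]

/-- Cancelling common powers leaves a relation between a power of `X` and a power of `Y`. Its
exponents can be divided by their greatest common divisor because an ordered group has no torsion.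
-/
theorem exists_coprime_pow_eq {X Y : Γ} (hX0 : X ≠ 0) (hY0 : Y ≠ 0) (hX : X ≤ 1) (hY : Y ≤ 1)
    (hXY : X < 1 ∨ Y < 1) {a b a' b' : ℕ} (hne : a ≠ a' ∨ b ≠ b')
    (h : X ^ a * Y ^ b = X ^ a' * Y ^ b') : ∃ p q : ℕ, p.Coprime q ∧ X ^ q = Y ^ p := by
  wlog haa : a' ≤ a generalizing a b a' b'
  · exact this (hne.imp Ne.symm Ne.symm) h.symm (le_of_not_ge haa)
  obtain ⟨A, rfl⟩ := Nat.exists_eq_add_of_le haa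
  rw [pow_add, mul_assoc] at h
  have h := mul_left_cancel₀ (pow_ne_zero _ hX0) h
  have key : ∀ D : ℕ, (A ≠ 0 ∨ D ≠ 0) → X ^ A = Y ^ D →
      ∃ p q : ℕ, p.Coprime q ∧ X ^ q = Y ^ p := by
    intro D hAD hpow
    have hg : 0 < Nat.gcd D A := Nat.pos_of_ne_zero fun h0 => by
      rw [Nat.gcd_eq_zero_iff] at h0
      omega
    refine ⟨D / Nat.gcd D A, A / Nat.gcd D A, Nat.coprime_div_gcd_div_gcd hg, ?_⟩
    refine (pow_left_inj₀ zero_le zero_le hg.ne').mp ?_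
    rw [← pow_mul, ← pow_mul, Nat.div_mul_cancel (Nat.gcd_dvd_right _ _),
      Nat.div_mul_cancel (Nat.gcd_dvd_left _ _), hpow]
  rcases le_total b b' with hbb | hbb
  · obtain ⟨D, rfl⟩ := Nat.exists_eq_add_of_le hbb
    refine key D (by omega) ?_
    rw [pow_add, mul_comm (Y ^ b)] at h
    exact mul_right_cancel₀ (pow_ne_zero _ hY0) h
  · obtain ⟨D, rfl⟩ := Nat.exists_eq_add_of_le hbb
    -- When the powers end up on the same side, both factors are at most `1` and must equal `1`. So
    -- one of `X`, `Y` is `1`, and the direction is `(0, 1)` or `(1, 0)`.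
    have h1 : X ^ A * Y ^ D = 1 := by
      refine mul_right_cancel₀ (pow_ne_zero b' hY0) ?_
      rw [one_mul, mul_assoc, ← pow_add, add_comm D, h]
    have hXA : X ^ A = 1 := by
      refine le_antisymm (pow_le_one₀ zero_le hX) ?_
      rw [← h1]
      exact mul_le_of_le_one_right zero_le (pow_le_one₀ zero_le hY)
    have hYD : Y ^ D = 1 := by rwa [hXA, one_mul] at h1
    rcases hXY with hlt | hlt
    · refine ⟨1, 0, by simp, ?_⟩
      have hA : A = 0 := by
        by_contra h0
        exact (pow_lt_one₀ zero_le hlt h0).ne hXA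
      have hD : D ≠ 0 := by omega
      rw [pow_zero, pow_one]
      exact ((pow_eq_one_iff.mp hYD).resolve_right hD).symm
    · refine ⟨0, 1, by simp, ?_⟩
      have hD : D = 0 := by
        by_contra h0
        exact (pow_lt_one₀ zero_le hlt h0).ne hYD
      have hA : A ≠ 0 := by omega
      rw [pow_zero, pow_one]
      exact (pow_eq_one_iff.mp hXA).resolve_right hA

theorem zpow_le_one_of_sign {z : Γ} {n : ℤ}
    (h : (z ≤ 1 ∧ 0 ≤ n) ∨ (1 ≤ z ∧ n ≤ 0)) : z ^ n ≤ 1 := by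
  rcases h with ⟨hz, hn⟩ | ⟨hz, hn⟩
  · obtain ⟨m, rfl⟩ := Int.eq_ofNat_of_zero_le hn
    rw [zpow_natCast]
    exact pow_le_one₀ zero_le hz
  · obtain ⟨m, hm⟩ := Int.eq_ofNat_of_zero_le (neg_nonneg.mpr hn)
    rw [← neg_neg n, hm, zpow_neg, zpow_natCast]
    exact inv_le_one_of_one_le₀ (one_le_pow₀ hz)

/-- The vectors `(p, q)` and `(q, -p)` are orthogonal of squared length `p ^ 2 + q ^ 2`, so `(a, b)`
decomposes along them with that denominator. Passing to this power is harmless for comparisons with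
`1`, which can then be read off from the signs of the two components. -/
theorem monomial_rotation {X Y : Γ} (hX0 : X ≠ 0) (hY0 : Y ≠ 0) (p q : ℕ) (a b : ℤ) :
    (X ^ a * Y ^ b) ^ (p ^ 2 + q ^ 2) =
      (X ^ p * Y ^ q) ^ (a * p + b * q) * (X ^ q * (Y ^ p)⁻¹) ^ (a * q - b * p) := by
  have hY : (Y ^ p)⁻¹ = Y ^ (-(p : ℤ)) := by rw [zpow_neg, zpow_natCast]
  rw [hY, ← zpow_natCast, ← zpow_natCast X p, ← zpow_natCast Y q, ← zpow_natCast X q, mul_zpow,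
    mul_zpow, mul_zpow]
  simp only [← zpow_mul]
  rw [mul_mul_mul_comm, ← zpow_add₀ hX0, ← zpow_add₀ hY0]
  push_cast
  congr 2 <;> ring

theorem monomial_le_one {X Y : Γ} (hX0 : X ≠ 0) (hY0 : Y ≠ 0) {p q : ℕ} (hp : 0 < p) {a b : ℤ}
    (hZ : X ^ p * Y ^ q ≤ 1) (hpos : 0 < a * p + b * q)
    (h : (X ^ q * (Y ^ p)⁻¹ ≤ 1 ∧ 0 ≤ a * q - b * p) ∨
      (1 ≤ X ^ q * (Y ^ p)⁻¹ ∧ a * q - b * p ≤ 0)) : X ^ a * Y ^ b ≤ 1 := by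
  have hD : p ^ 2 + q ^ 2 ≠ 0 := by positivity
  refine (pow_le_one_iff_of_nonneg zero_le hD).mp ?_
  rw [monomial_rotation hX0 hY0]
  exact mul_le_one' (zpow_le_one_of_sign (.inl ⟨hZ, hpos.le⟩))
    (zpow_le_one_of_sign h)

theorem monomial_lt_one {X Y : Γ} (hX0 : X ≠ 0) (hY0 : Y ≠ 0) {p q : ℕ} (hp : 0 < p) {a b : ℤ}
    (hZ : X ^ p * Y ^ q < 1) (hpos : 0 < a * p + b * q)
    (h : (X ^ q * (Y ^ p)⁻¹ ≤ 1 ∧ 0 ≤ a * q - b * p) ∨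
      (1 ≤ X ^ q * (Y ^ p)⁻¹ ∧ a * q - b * p ≤ 0)) : X ^ a * Y ^ b < 1 := by
  have hD : p ^ 2 + q ^ 2 ≠ 0 := by positivity
  refine (pow_lt_one_iff_of_nonneg zero_le hD).mp ?_
  rw [monomial_rotation hX0 hY0]
  refine lt_of_le_of_lt (mul_le_of_le_one_right zero_le
    (zpow_le_one_of_sign h)) ?_
  obtain ⟨m, hm⟩ := Int.eq_ofNat_of_zero_le hpos.le
  rw [hm, zpow_natCast]
  refine pow_lt_one₀ zero_le hZ ?_
  rintro rfl
  rw [hm] at hpos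
  exact lt_irrefl _ hpos

end OrderedGroup

end Delsarte

end

noncomputable section

namespace Delsarte

/-! ### Uniqueness of the direction at a point, and the toric chart -/

section Directions

/-- A generic positive combination of two independent directions separates four points. -/
theorem exists_generic_direction {α β : Fin 4 → ℕ}
    (hne : ∀ i j, i ≠ j → α i ≠ α j ∨ β i ≠ β j) {p q p' q' : ℕ} (hlt : p' * q < p * q') :
    ∃ s : ℕ, 0 < s ∧ ∀ i j, i ≠ j →
      ((α i : ℤ) - α j) * (p + s * p' : ℕ) + ((β i : ℤ) - β j) * (q + s * q' : ℕ) ≠ 0 := by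
  let bad : Fin 4 → Fin 4 → Set ℕ := fun i j => {s | i ≠ j ∧
    ((α i : ℤ) - α j) * (p + s * p' : ℕ) + ((β i : ℤ) - β j) * (q + s * q' : ℕ) = 0}
  have hlt' : (p' : ℤ) * q < p * q' := by exact_mod_cast hlt
  have hfin : ∀ i j, (bad i j).Finite := by
    intro i j
    refine Set.Subsingleton.finite ?_
    rintro s ⟨hij, hs⟩ s' ⟨-, hs'⟩
    by_contra hss
    have hss' : (s : ℤ) - s' ≠ 0 := by
      intro h; apply hss; exact_mod_cast sub_eq_zero.mp h
    push_cast at hs hs'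
    set a : ℤ := (α i : ℤ) - α j with ha
    set b : ℤ := (β i : ℤ) - β j with hb
    have h1 : a * p' + b * q' = 0 := by
      have : ((s : ℤ) - s') * (a * p' + b * q') = 0 := by linear_combination hs - hs'
      exact (mul_eq_zero.mp this).resolve_left hss'
    have h2 : a * p + b * q = 0 := by linear_combination hs - s * h1
    have hd : (p : ℤ) * q' - p' * q ≠ 0 := by omega
    have ha0 : a = 0 := by
      have : a * (p * q' - p' * q) = 0 := by linear_combination q' * h2 - q * h1
      exact (mul_eq_zero.mp this).resolve_right hd
    have hb0 : b = 0 := by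
      have : b * (p * q' - p' * q) = 0 := by linear_combination p * h1 - p' * h2
      exact (mul_eq_zero.mp this).resolve_right hd
    rcases hne i j hij with h | h <;> omega
  have hall : ({0} ∪ ⋃ i, ⋃ j, bad i j).Finite :=
    (Set.finite_singleton 0).union (Set.finite_iUnion fun i => Set.finite_iUnion fun j => hfin i j)
  obtain ⟨s, hs⟩ := hall.exists_notMem
  simp only [Set.mem_union, Set.mem_singleton_iff, Set.mem_iUnion, not_or, not_exists] at hs
  exact ⟨s, Nat.pos_of_ne_zero hs.1, fun i j hij h => hs.2 i j ⟨hij, h⟩⟩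

variable {L : Type*} [Field L] {B : Subring L} {P : Ideal B} {x y φ : L} {α β : Fin 4 → ℕ}

/-- Data of a point of the normalization `B` of a family
`n₀ + n₁ + n₂ + φ n₃ = 0`, `n_l = x ^ α_l y ^ β_l`, with `φ ≠ 0`. -/
structure IsFamilyPoint (P : Ideal B) (x y φ : L) (α β : Fin 4 → ℕ) : Prop where
  x_ne : x ≠ 0
  y_ne : y ≠ 0
  x_mem : x ∈ B
  y_mem : y ∈ B
  φ_mem : φ ∈ B
  φ_notMem : (⟨φ, φ_mem⟩ : B) ∉ P
  distinct : ∀ i j, i ≠ j → α i ≠ α j ∨ β i ≠ β j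
  relation : ∑ l, ![1, 1, 1, φ] l * (x ^ α l * y ^ β l) = 0

namespace IsFamilyPoint

theorem coeff_mem (h : IsFamilyPoint P x y φ α β) (l : Fin 4) :
    (![1, 1, 1, φ] : Fin 4 → L) l ∈ B := by
  fin_cases l
  · exact one_mem B
  · exact one_mem B
  · exact one_mem B
  · exact h.φ_mem

theorem coeff_notMem [P.IsPrime] (h : IsFamilyPoint P x y φ α β) (l : Fin 4) :
    (⟨_, h.coeff_mem l⟩ : B) ∉ P := by
  have h1 : (1 : B) ∉ P := fun h1 => Ideal.IsPrime.ne_top ‹_› ((Ideal.eq_top_iff_one P).mpr h1)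
  fin_cases l
  · exact h1
  · exact h1
  · exact h1
  · exact h.φ_notMem

variable [P.IsPrime] {V V' : ValuationSubring L}

/-- Four terms with sum zero cannot have pairwise distinct values. The coefficients, including `φ`,
have value `1`, so two distinct monomials in `x` and `y` have equal value. -/
theorem exists_direction (h : IsFamilyPoint P x y φ α β) (hV : Dominates V P)
    (hlt : V.valuation x < 1 ∨ V.valuation y < 1) :
    ∃ p q : ℕ, p.Coprime q ∧ V.valuation x ^ q = V.valuation y ^ p := by
  set v := V.valuation
  have hx0 : v x ≠ 0 := (Valuation.ne_zero_iff v).mpr h.x_ne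
  have hy0 : v y ≠ 0 := (Valuation.ne_zero_iff v).mpr h.y_ne
  set n : Fin 4 → L := fun l => ![1, 1, 1, φ] l * (x ^ α l * y ^ β l) with hn
  have hvn : ∀ l, v (n l) = v x ^ α l * v y ^ β l := by
    intro l
    have := hV.valuation_eq_one (h.coeff_notMem l)
    simp only [hn, map_mul, map_pow]
    rw [this, one_mul]
  obtain ⟨i, j, hij, heq⟩ : ∃ i j, i ≠ j ∧ v (n i) = v (n j) := by
    by_contra! hcon
    obtain ⟨i, hi⟩ := Finite.exists_max fun l => v (n l)
    have hi0 : v (n i) ≠ 0 := by rw [hvn]; exact mul_ne_zero (pow_ne_zero _ hx0) (pow_ne_zero _ hy0)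
    have hs : v (∑ l ∈ Finset.univ.erase i, n l) < v (n i) :=
      Valuation.map_sum_lt v hi0 fun l hl =>
        lt_of_le_of_ne (hi l) (hcon l i (Finset.ne_of_mem_erase hl))
    have hsum : ∑ l ∈ Finset.univ.erase i, n l = - n i := by
      rw [eq_neg_iff_add_eq_zero, Finset.sum_erase_add _ _ (Finset.mem_univ i)]
      exact h.relation
    rw [hsum, Valuation.map_neg] at hs
    exact lt_irrefl _ hs
  rw [hvn, hvn] at heq
  exact exists_coprime_pow_eq hx0 hy0 (hV.valuation_le_one h.x_mem) (hV.valuation_le_one h.y_mem)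
    hlt (h.distinct i j hij) heq

/-- This is a connectedness argument. Divide the equation by the monomial that is extremal in a
direction strictly between the two, and split the other terms by the side of that direction on which
they lie. Integral closedness puts both partial sums into `B`; each valuation forces one of them
into `P`, although together they add up to minus a coefficient outside `P`. -/
theorem not_lt_of_dominates [IsIntegrallyClosedIn B L] (h : IsFamilyPoint P x y φ α β)
    (hV : Dominates V P) (hV' : Dominates V' P)
    (hlt : V.valuation x < 1 ∨ V.valuation y < 1) (hlt' : V'.valuation x < 1 ∨ V'.valuation y < 1)
    {p q p' q' : ℕ} (hpq : V.valuation x ^ q = V.valuation y ^ p)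
    (hpq' : V'.valuation x ^ q' = V'.valuation y ^ p') : ¬ p' * q < p * q' := by
  intro hdet
  obtain ⟨s, hs0, hs⟩ := exists_generic_direction h.distinct hdet
  set p₀ := p + s * p' with hp₀
  set q₀ := q + s * q' with hq₀
  have hp : 0 < p := Nat.pos_of_ne_zero fun h0 => by simp [h0] at hdet
  have hq' : 0 < q' := Nat.pos_of_ne_zero fun h0 => by simp [h0] at hdet
  have hp₀pos : 0 < p₀ := by omega
  have hq₀pos : 0 < q₀ := by positivity
  have hdet1 : q * p₀ < q₀ * p := by
    have : q * p₀ + s * (p * q') = q₀ * p + s * (p' * q) := by rw [hp₀, hq₀]; ring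
    have := Nat.mul_lt_mul_of_pos_left hdet hs0
    omega
  have hdet2 : p' * q₀ < p₀ * q' := by
    have : p' * q₀ + p * q' = p₀ * q' + p' * q := by rw [hp₀, hq₀]; ring
    omega
  obtain ⟨i, hi⟩ := Finite.exists_min fun l : Fin 4 => (α l : ℤ) * p₀ + β l * q₀
  have hmin : ∀ l, l ≠ i → 0 < ((α l : ℤ) - α i) * p₀ + ((β l : ℤ) - β i) * q₀ := by
    intro l hl
    refine lt_of_le_of_ne ?_ (hs l i hl).symm
    linarith [hi l]
  -- the two parts of the equation divided by the extremal monomial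
  set m : Fin 4 → L := fun l => x ^ ((α l : ℤ) - α i) * y ^ ((β l : ℤ) - β i) with hm
  set c : Fin 4 → L := ![1, 1, 1, φ] with hc
  set δ : Fin 4 → ℤ := fun l => ((α l : ℤ) - α i) * q₀ - ((β l : ℤ) - β i) * p₀ with hδ
  set S := ∑ l ∈ Finset.univ.erase i with 0 < δ l, c l * m l with hS
  set S' := ∑ l ∈ Finset.univ.erase i with ¬ 0 < δ l, c l * m l with hS'
  have hsum : S + S' = - c i := by
    rw [hS, hS', Finset.sum_filter_add_sum_filter_not, eq_neg_iff_add_eq_zero]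
    have hmi : c i = c i * m i := by simp [hm]
    rw [hmi, Finset.sum_erase_add _ _ (Finset.mem_univ i)]
    have : ∀ l, c l * m l = (x ^ α i * y ^ β i)⁻¹ * (c l * (x ^ α l * y ^ β l)) := by
      intro l
      simp only [hm]
      rw [zpow_sub₀ h.x_ne, zpow_sub₀ h.y_ne]
      simp only [zpow_natCast]
      field_simp
    rw [Finset.sum_congr rfl fun l _ => this l, ← Finset.mul_sum, h.relation, mul_zero]
  have hv0 : ∀ (W : ValuationSubring L) (z : L), z ≠ 0 → W.valuation z ≠ 0 := fun W z hz =>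
    (Valuation.ne_zero_iff W.valuation).mpr hz
  have hvm : ∀ (W : ValuationSubring L) (l), W.valuation (m l) =
      W.valuation x ^ ((α l : ℤ) - α i) * W.valuation y ^ ((β l : ℤ) - β i) := by
    intro W l
    simp [hm, map_mul, map_zpow₀]
  -- For any valuation ring `W` containing `B`, the element `x ^ q₀ * y ^ (-p₀)` has value at most
  -- or at least `1`. Accordingly `W` contains all terms of `S` or all terms of `S'`; either way it
  -- contains `S`, since `S + S' = - c i`.
  have hSB : S ∈ B := by
    by_contra hSB
    obtain ⟨W, hBW, hSW⟩ := Subring.exists_le_valuationSubring_of_isIntegrallyClosedIn hSB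
    refine hSW ?_
    have hle : ∀ z ∈ B, W.valuation z ≤ 1 := fun z hz => (W.valuation_le_one_iff z).mpr (hBW hz)
    have hZ : W.valuation x ^ p₀ * W.valuation y ^ q₀ ≤ 1 :=
      mul_le_one' (pow_le_one₀ zero_le (hle x h.x_mem)) (pow_le_one₀ zero_le (hle y h.y_mem))
    rcases le_total (W.valuation x ^ q₀ * (W.valuation y ^ p₀)⁻¹) 1 with hz | hz
    · refine W.sum_mem fun l hl => W.mul_mem _ _ (hBW (h.coeff_mem l)) ?_
      obtain ⟨hl, hδl⟩ := Finset.mem_filter.mp hl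
      rw [← W.valuation_le_one_iff, hvm]
      exact monomial_le_one (hv0 W x h.x_ne) (hv0 W y h.y_ne) hp₀pos hZ
        (hmin l (Finset.ne_of_mem_erase hl)) (.inl ⟨hz, hδl.le⟩)
    · rw [eq_sub_of_add_eq hsum]
      refine W.sub_mem (W.neg_mem _ (hBW (h.coeff_mem i)))
        (W.sum_mem fun l hl => W.mul_mem _ _ (hBW (h.coeff_mem l)) ?_)
      obtain ⟨hl, hδl⟩ := Finset.mem_filter.mp hl
      rw [← W.valuation_le_one_iff, hvm]
      exact monomial_le_one (hv0 W x h.x_ne) (hv0 W y h.y_ne) hp₀pos hZ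
        (hmin l (Finset.ne_of_mem_erase hl)) (.inr ⟨hz, not_lt.mp hδl⟩)
  have hSB' : S' ∈ B := by
    rw [eq_sub_of_add_eq' hsum]
    exact sub_mem (neg_mem (h.coeff_mem i)) hSB
  -- general facts on a dominating valuation
  have hZlt : ∀ W : ValuationSubring L, Dominates W P → (W.valuation x < 1 ∨ W.valuation y < 1) →
      W.valuation x ^ p₀ * W.valuation y ^ q₀ < 1 := by
    intro W hW hWlt
    have hx1 := pow_le_one₀ (n := p₀) zero_le (hW.valuation_le_one h.x_mem)
    have hy1 := pow_le_one₀ (n := q₀) zero_le (hW.valuation_le_one h.y_mem)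
    rcases hWlt with hlt | hlt
    · exact lt_of_le_of_lt (mul_le_of_le_one_right zero_le hy1) (pow_lt_one₀ zero_le hlt hp₀pos.ne')
    · exact lt_of_le_of_lt (mul_le_of_le_one_left zero_le hx1) (pow_lt_one₀ zero_le hlt hq₀pos.ne')
  -- The directions of `V` and `V'` lie on opposite sides of `(p₀, q₀)`, so the transverse monomial
  -- is at most `1` for `V` and at least `1` for `V'`.
  have hz : V.valuation x ^ q₀ * (V.valuation y ^ p₀)⁻¹ ≤ 1 := by
    have hx1 : V.valuation x < 1 := by
      by_contra hx1
      have hx1 : V.valuation x = 1 := le_antisymm (hV.valuation_le_one h.x_mem) (not_lt.mp hx1)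
      rw [hx1, one_pow, eq_comm, pow_eq_one_iff] at hpq
      rw [hx1, hpq.resolve_right hp.ne'] at hlt
      simp at hlt
    rw [mul_inv_le_iff₀ (pow_pos (zero_lt_iff.mpr (hv0 V y h.y_ne)) _), one_mul]
    refine (pow_le_pow_iff_left₀ zero_le zero_le hp.ne').mp ?_
    rw [← pow_mul, ← pow_mul, mul_comm p₀, pow_mul (V.valuation y), ← hpq, ← pow_mul]
    exact pow_le_pow_of_le_one zero_le hx1.le hdet1.le
  have hz' : 1 ≤ V'.valuation x ^ q₀ * (V'.valuation y ^ p₀)⁻¹ := by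
    have hy1 : V'.valuation y ≤ 1 := hV'.valuation_le_one h.y_mem
    rw [le_mul_inv_iff₀ (pow_pos (zero_lt_iff.mpr (hv0 V' y h.y_ne)) _), one_mul]
    refine (pow_le_pow_iff_left₀ zero_le zero_le hq'.ne').mp ?_
    rw [← pow_mul, ← pow_mul, mul_comm q₀, pow_mul (V'.valuation x), hpq', ← pow_mul]
    exact pow_le_pow_of_le_one zero_le hy1 hdet2.le
  have hSP : (⟨S, hSB⟩ : B) ∈ P := by
    rw [← hV.lt_one_iff]
    change V.valuation S < 1
    refine Valuation.map_sum_lt V.valuation one_ne_zero fun l hl => ?_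
    obtain ⟨hl, hδl⟩ := Finset.mem_filter.mp hl
    rw [map_mul, hV.valuation_eq_one (h.coeff_notMem l), one_mul, hvm]
    exact monomial_lt_one (hv0 V x h.x_ne) (hv0 V y h.y_ne) hp₀pos (hZlt V hV hlt)
        (hmin l (Finset.ne_of_mem_erase hl)) (.inl ⟨hz, hδl.le⟩)
  have hSP' : (⟨S', hSB'⟩ : B) ∈ P := by
    rw [← hV'.lt_one_iff]
    change V'.valuation S' < 1
    refine Valuation.map_sum_lt V'.valuation one_ne_zero fun l hl => ?_
    obtain ⟨hl, hδl⟩ := Finset.mem_filter.mp hl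
    rw [map_mul, hV'.valuation_eq_one (h.coeff_notMem l), one_mul, hvm]
    exact monomial_lt_one (hv0 V' x h.x_ne) (hv0 V' y h.y_ne) hp₀pos (hZlt V' hV' hlt')
        (hmin l (Finset.ne_of_mem_erase hl)) (.inr ⟨hz', not_lt.mp hδl⟩)
  refine h.coeff_notMem i ?_
  have : (⟨_, h.coeff_mem i⟩ : B) = - (⟨S, hSB⟩ + ⟨S', hSB'⟩) := by
    refine Subtype.ext ?_
    change c i = - (S + S')
    rw [hsum, neg_neg]
  rw [this]
  exact neg_mem (add_mem hSP hSP')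

/-- Near every point, the normalization is contained in a toric chart. -/
theorem exists_chart [IsIntegrallyClosedIn B L] (h : IsFamilyPoint P x y φ α β) :
    ∃ p q : ℕ, ∃ a b : ℤ, a * p + b * q = 1 ∧ IsLocalAt P (x ^ a * y ^ b) ∧
      IsLocalAt P (x ^ (q : ℤ) * y ^ (-(p : ℤ))) ∧
      IsLocalAt P (x ^ (q : ℤ) * y ^ (-(p : ℤ)))⁻¹ := by
  by_cases hxy : (⟨x, h.x_mem⟩ : B) ∉ P ∧ (⟨y, h.y_mem⟩ : B) ∉ P
  · have h1 : (1 : B) ∉ P := fun h1 => Ideal.IsPrime.ne_top ‹_› ((Ideal.eq_top_iff_one P).mpr h1)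
    -- At a point of the torus the coordinates `u = x` and `w = y⁻¹` already work.
    refine ⟨1, 0, 1, 0, by simp, ⟨1, h1, ⟨x, h.x_mem⟩, by simp⟩, ⟨⟨y, h.y_mem⟩, hxy.2, 1, ?_⟩,
      ⟨1, h1, ⟨y, h.y_mem⟩, by simp⟩⟩
    simp [h.y_ne]
  · have hlt : ∀ V : ValuationSubring L, Dominates V P →
        (V.valuation x < 1 ∨ V.valuation y < 1) := by
      intro V hV
      rw [not_and_or, not_not, not_not] at hxy
      exact hxy.imp (hV.lt_one_iff _).mpr (hV.lt_one_iff _).mpr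
    obtain ⟨V, hV⟩ := exists_dominates P
    obtain ⟨p, q, hcop, hpq⟩ := h.exists_direction hV (hlt V hV)
    have hall : ∀ W : ValuationSubring L, Dominates W P →
        W.valuation x ^ q = W.valuation y ^ p := by
      intro W hW
      obtain ⟨p', q', hcop', hpq'⟩ := h.exists_direction hW (hlt W hW)
      have h1 := h.not_lt_of_dominates hV hW (hlt V hV) (hlt W hW) hpq hpq'
      have h2 := h.not_lt_of_dominates hW hV (hlt W hW) (hlt V hV) hpq' hpq
      have heq : p * q' = p' * q := le_antisymm (not_lt.mp h1) (not_lt.mp h2)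
      have hpp : p = p' := Nat.dvd_antisymm
        (hcop.dvd_of_dvd_mul_right (heq ▸ dvd_mul_right p q'))
        (hcop'.dvd_of_dvd_mul_right (heq ▸ dvd_mul_right p' q))
      have hqq : q = q' := Nat.dvd_antisymm
        (hcop.symm.dvd_of_dvd_mul_left (heq ▸ dvd_mul_left q p'))
        (hcop'.symm.dvd_of_dvd_mul_left (heq ▸ dvd_mul_left q' p))
      rw [hpp, hqq]
      exact hpq'
    have hw1 : ∀ W : ValuationSubring L, Dominates W P →
        W.valuation (x ^ (q : ℤ) * y ^ (-(p : ℤ))) = 1 := by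
      intro W hW
      have : W.valuation y ^ p ≠ 0 := pow_ne_zero _ ((Valuation.ne_zero_iff _).mpr h.y_ne)
      rw [map_mul, map_zpow₀, map_zpow₀, zpow_neg, zpow_natCast, zpow_natCast, hall W hW,
        mul_inv_cancel₀ this]
    obtain ⟨a, b, hab⟩ := (Nat.isCoprime_iff_coprime.mpr hcop : IsCoprime (p : ℤ) q)
    refine ⟨p, q, a, b, hab, ?_, ?_, ?_⟩
    · refine isLocalAt_of_forall_dominates fun W hW => ?_
      rw [← W.valuation_le_one_iff]
      -- Since `w` has value `1`, regularity of `u` follows from `x = u ^ p * w ^ b` when `p > 0`,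
      -- and from `y = u ^ q * w ^ (-a)` when `p = 0`.
      have hmon : ∀ (i j : ℤ) (n : ℕ), a * n + q * i = j →
          b * n - p * i = 1 - j → (j = 0 ∨ j = 1) → n ≠ 0 →
          W.valuation (x ^ a * y ^ b) ≤ 1 := by
        intro i j n h1 h2 hj hn
        refine (pow_le_one_iff_of_nonneg zero_le hn).mp ?_
        have h3 : (x ^ a * y ^ b) ^ n * (x ^ (q : ℤ) * y ^ (-(p : ℤ))) ^ i =
            x ^ j * y ^ (1 - j) := by
          rw [← zpow_natCast, mul_zpow, mul_zpow, ← zpow_mul, ← zpow_mul, ← zpow_mul, ← zpow_mul,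
            mul_mul_mul_comm, ← zpow_add₀ h.x_ne, ← zpow_add₀ h.y_ne, h1, ← h2]
          congr 2
          ring
        have h4 := congrArg W.valuation h3
        rw [map_mul, map_zpow₀, hw1 W hW, one_zpow, mul_one, map_pow] at h4
        rw [h4]
        rcases hj with rfl | rfl
        · simpa using hW.valuation_le_one h.y_mem
        · simpa using hW.valuation_le_one h.x_mem
      rcases Nat.eq_zero_or_pos p with hp | hp
      · refine hmon (-a) 0 q (by ring) ?_ (.inl rfl) ?_
        · linear_combination hab
        · rintro rfl
          simp [hp] at hab
      · exact hmon b 1 p (by linear_combination hab) (by ring) (.inr rfl) hp.ne'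
    · refine isLocalAt_of_forall_dominates fun W hW => ?_
      rw [← W.valuation_le_one_iff, hw1 W hW]
    · refine isLocalAt_of_forall_dominates fun W hW => ?_
      rw [← W.valuation_le_one_iff, map_inv₀, hw1 W hW, inv_one]

end IsFamilyPoint

end Directions

end Delsarte

end

noncomputable section

namespace Delsarte

open Polynomial

/-! ### Transfer to the toric coordinates -/

section IsLocalAt

variable {L : Type*} [Field L] {B : Subring L} {P : Ideal B} [hP : P.IsPrime]

theorem isLocalAt_of_mem {z : L} (hz : z ∈ B) : IsLocalAt P z :=
  ⟨1, fun h1 => hP.ne_top ((Ideal.eq_top_iff_one P).mpr h1), ⟨z, hz⟩, by simp⟩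

theorem IsLocalAt.mul {z z' : L} (h : IsLocalAt P z) (h' : IsLocalAt P z') :
    IsLocalAt P (z * z') := by
  obtain ⟨f, hf, b, hb⟩ := h
  obtain ⟨f', hf', b', hb'⟩ := h'
  refine ⟨f * f', fun hm => (hP.mem_or_mem hm).elim hf hf', b * b', ?_⟩
  push_cast
  rw [← hb, ← hb']
  ring

theorem IsLocalAt.add {z z' : L} (h : IsLocalAt P z) (h' : IsLocalAt P z') :
    IsLocalAt P (z + z') := by
  obtain ⟨f, hf, b, hb⟩ := h
  obtain ⟨f', hf', b', hb'⟩ := h'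
  refine ⟨f * f', fun hm => (hP.mem_or_mem hm).elim hf hf', f' * b + f * b', ?_⟩
  push_cast
  rw [← hb, ← hb']
  ring

theorem IsLocalAt.pow {z : L} (h : IsLocalAt P z) (n : ℕ) : IsLocalAt P (z ^ n) := by
  induction n with
  | zero => simpa using isLocalAt_of_mem (one_mem B)
  | succ n ih => rw [pow_succ]; exact ih.mul h

theorem IsLocalAt.zpow {z : L} (h : IsLocalAt P z) (h' : IsLocalAt P z⁻¹) (n : ℤ) :
    IsLocalAt P (z ^ n) := by
  rcases n with n | n
  · simpa using h.pow n
  · rw [zpow_negSucc, ← inv_pow]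
    exact h'.pow _

theorem isLocalAt_toricMap {K : Type*} [Field K] [Algebra K L] (hK : ∀ c : K, algebraMap K L c ∈ B)
    {u : L} {w : Lˣ} (hu : IsLocalAt P u) (hw : IsLocalAt P (w : L))
    (hw' : IsLocalAt P (w : L)⁻¹) (a : ToricRing K) : IsLocalAt P (toricMap u w a) := by
  have ha : a ∈ Submodule.span K (Set.range fun m : ℕ × ℤ => toricMonomial (K := K) m.1 m.2) :=
    span_range_toricMonomial (K := K) ▸ Submodule.mem_top
  induction ha using Submodule.span_induction with
  | mem _ hm =>
    obtain ⟨m, rfl⟩ := hm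
    rw [toricMap_monomial]
    exact (hu.pow _).mul (hw.zpow hw' _)
  | zero => rw [map_zero]; exact isLocalAt_of_mem (zero_mem B)
  | add _ _ _ _ h h' => rw [map_add]; exact h.add h'
  | smul c _ _ h =>
    rw [map_smul, Algebra.smul_def]
    exact (isLocalAt_of_mem (hK c)).mul h

end IsLocalAt

section RelationVector

/-- Relation vectors are invariant under affine unimodular transformations. -/
theorem IsRelationVector.transform {K : Type*} [Field K] {α β e f k : Fin 4 → ℤ}
    (hk : IsRelationVector K α β k) {p q a b m : ℤ} (hdet : a * p + b * q = 1)
    (he : ∀ l, e l = α l * p + β l * q - m) (hf : ∀ l, f l = b * α l - a * β l) :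
    IsRelationVector K e f k := by
  have h1 := hk.sum_eq_zero
  have h2 := hk.sum_fst
  have h3 := hk.sum_snd
  simp only [Fin.sum_univ_four] at h1 h2 h3
  refine ⟨hk.sum_eq_zero, ?_, ?_, hk.last_ne_zero, fun z z1 z2 z3 => ?_⟩
  · simp only [Fin.sum_univ_four, he]
    linear_combination p * h2 + q * h3 - m * h1
  · simp only [Fin.sum_univ_four, hf]
    linear_combination b * h2 - a * h3
  · have hdet' : (a : K) * p + b * q = 1 := by
      have := congrArg (Int.cast : ℤ → K) hdet
      push_cast at this
      exact this
    have z1' := z1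
    simp only [Fin.sum_univ_four, he, hf] at z1' z2 z3
    push_cast at z2 z3
    refine hk.unique z z1 ?_ ?_
    · simp only [Fin.sum_univ_four]
      linear_combination a * z2 + q * z3 + a * m * z1' -
        (α 0 * z 0 + α 1 * z 1 + α 2 * z 2 + α 3 * z 3) * hdet'
    · simp only [Fin.sum_univ_four]
      linear_combination b * z2 - p * z3 + b * m * z1' -
        (β 0 * z 0 + β 1 * z 1 + β 2 * z 2 + β 3 * z 3) * hdet'

end RelationVector

section Generation

variable {K A L : Type*} [Field K] [Field L] [Algebra K L] [CommRing A] [Algebra K A]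
  [Algebra A L] [IsScalarTower K A L] [IsFractionRing A L]

/-- If `τ` is a quotient of polynomials in `x` and `y`, the function field is generated by
`x` and `y`. -/
theorem adjoin_pair_eq_top {x y τ : A} (hgenA : Algebra.adjoin K {x, y, τ} = ⊤)
    (hx : algebraMap A L x ≠ 0) (hy : algebraMap A L y ≠ 0) {α β : Fin 4 → ℕ}
    (hrel : ∑ l, ![1, 1, 1, τ] l * (x ^ α l * y ^ β l) = 0) :
    IntermediateField.adjoin K {algebraMap A L x, algebraMap A L y} = ⊤ := by
  set F := IntermediateField.adjoin K {algebraMap A L x, algebraMap A L y} with hF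
  have hxF : algebraMap A L x ∈ F := IntermediateField.subset_adjoin _ _ (by simp)
  have hyF : algebraMap A L y ∈ F := IntermediateField.subset_adjoin _ _ (by simp)
  have hnF : ∀ l, algebraMap A L (x ^ α l * y ^ β l) ∈ F := fun l => by
    rw [map_mul, map_pow, map_pow]
    exact mul_mem (pow_mem hxF _) (pow_mem hyF _)
  have hτF : algebraMap A L τ ∈ F := by
    have hn0 : algebraMap A L (x ^ α 3 * y ^ β 3) ≠ 0 := by
      rw [map_mul, map_pow, map_pow]
      exact mul_ne_zero (pow_ne_zero _ hx) (pow_ne_zero _ hy)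
    have h1 := congrArg (algebraMap A L) hrel
    simp only [Fin.sum_univ_four, map_add, map_mul _ (![1, 1, 1, τ] _)] at h1
    simp only [Matrix.cons_val, map_one, one_mul, map_zero] at h1
    rw [eq_div_of_mul_eq hn0 (eq_neg_of_add_eq_zero_right h1)]
    exact div_mem (neg_mem (add_mem (add_mem (hnF 0) (hnF 1)) (hnF 2))) (hnF 3)
  have hle : Algebra.adjoin K {x, y, τ} ≤
      F.toSubalgebra.comap (IsScalarTower.toAlgHom K A L) := by
    refine Algebra.adjoin_le ?_
    rintro z (rfl | rfl | rfl)
    · exact hxF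
    · exact hyF
    · exact hτF
  rw [hgenA] at hle
  refine eq_top_iff.mpr fun z _ => ?_
  obtain ⟨p, q, -, rfl⟩ := IsFractionRing.div_surjective A z
  exact div_mem (hle (Algebra.mem_top (x := p))) (hle (Algebra.mem_top (x := q)))

end Generation

/-! ### Smoothness of the fibers of the normalized family -/

section Core

variable {K : Type*} [Field K] [IsAlgClosed K] [CharZero K]
  {L : Type*} [Field L] [Algebra K L] {A : Type*} [CommRing A] [Algebra K A]
  [Algebra A L] [IsScalarTower K A L] [IsFractionRing A L]

/-- The fiber of the normalized family over a non-critical value is formally smooth at every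
point. -/
theorem formallySmooth_atPrime {x y τ : A} (hgenA : Algebra.adjoin K {x, y, τ} = ⊤)
    (hx : x ≠ 0) (hy : y ≠ 0)
    (hind : AlgebraicIndependent K ![algebraMap A L x, algebraMap A L y])
    (hgen : IntermediateField.adjoin K {algebraMap A L x, algebraMap A L y} = ⊤)
    {α β : Fin 4 → ℕ} (hdist : ∀ i j, i ≠ j → α i ≠ α j ∨ β i ≠ β j)
    (hrel : ∑ l, ![1, 1, 1, τ] l * (x ^ α l * y ^ β l) = 0)
    {k : Fin 4 → ℤ} (hk : IsRelationVector K (fun l => (α l : ℤ)) (fun l => (β l : ℤ)) k)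
    {t : K} (ht : t ≠ 0) (hne : t ^ k 3 ≠ ∏ i with k i ≠ 0, (k i : K) ^ k i)
    (s : integralClosure A L) (hs : s = algebraMap A (integralClosure A L) (τ - algebraMap K A t))
    (𝔭 : Ideal (integralClosure A L ⧸ Ideal.span {s})) [𝔭.IsPrime] :
    Algebra.FormallySmooth K (Localization.AtPrime 𝔭) := by
  have hAL : Function.Injective (algebraMap A L) := IsFractionRing.injective A L
  set X := algebraMap A L x with hX
  set Y := algebraMap A L y with hY
  set φ := algebraMap A L τ with hφdef
  have hX0 : X ≠ 0 := by rwa [Ne, map_eq_zero_iff _ hAL]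
  have hY0 : Y ≠ 0 := by rwa [Ne, map_eq_zero_iff _ hAL]
  have hrelL : ∑ l, ![1, 1, 1, φ] l * (X ^ α l * Y ^ β l) = 0 := by
    have := congrArg (algebraMap A L) hrel
    simpa [Fin.sum_univ_four, hX, hY, hφdef] using this
  have hsL : (s : L) = φ - algebraMap K L t := by
    rw [hs, IsScalarTower.algebraMap_apply K A L, hφdef, ← map_sub]
    rfl
  let B : Subring L := (integralClosure A L).toSubring
  have hAB : ∀ a : A, algebraMap A L a ∈ B := fun a => (integralClosure A L).algebraMap_mem a
  have hKB : ∀ c : K, algebraMap K L c ∈ B := fun c => by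
    rw [IsScalarTower.algebraMap_apply K A L]
    exact hAB _
  let ι : B →+* integralClosure A L :=
    { toFun := fun b => ⟨b.1, b.2⟩
      map_one' := rfl
      map_mul' := fun _ _ => rfl
      map_zero' := rfl
      map_add' := fun _ _ => rfl }
  let P : Ideal B := (𝔭.comap (Ideal.Quotient.mk _)).comap ι
  have hPmem : ∀ b : B, b ∈ P ↔ Ideal.Quotient.mk (Ideal.span {s}) (ι b) ∈ 𝔭 := fun b => Iff.rfl
  have hP : P.IsPrime := inferInstance
  have hfam : IsFamilyPoint P X Y φ α β := by
    refine ⟨hX0, hY0, hAB x, hAB y, hAB τ, fun hmem => ?_, hdist, hrelL⟩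
    have hsP : (⟨s, s.2⟩ : B) ∈ P := by
      rw [hPmem]
      have : Ideal.Quotient.mk (Ideal.span {s}) s = 0 :=
        Ideal.Quotient.eq_zero_iff_mem.mpr (Ideal.mem_span_singleton_self s)
      change Ideal.Quotient.mk (Ideal.span {s}) s ∈ 𝔭
      rw [this]
      exact zero_mem 𝔭
    refine hP.ne_top ((Ideal.eq_top_iff_one P).mpr ?_)
    -- On the fiber `φ` equals the nonzero constant `t`, so it cannot lie in `P`.
    have h1 : (1 : B) = ⟨algebraMap K L t⁻¹, hKB _⟩ * (⟨φ, hAB τ⟩ - ⟨s, s.2⟩) := by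
      refine Subtype.ext ?_
      change (1 : L) = algebraMap K L t⁻¹ * (φ - s)
      rw [hsL, sub_sub_cancel, ← map_mul, inv_mul_cancel₀ ht, map_one]
    rw [h1]
    exact Ideal.mul_mem_left _ _ (sub_mem hmem hsP)
  obtain ⟨p, q, a, b, hdet, hu, hw, hw'⟩ := hfam.exists_chart
  -- toric coordinates
  obtain ⟨i₀, hi₀⟩ := Finite.exists_min fun l : Fin 4 => α l * p + β l * q
  set m := α i₀ * p + β i₀ * q with hm
  set e : Fin 4 → ℕ := fun l => α l * p + β l * q - m with he
  set f : Fin 4 → ℤ := fun l => b * α l - a * β l with hf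
  have heZ : ∀ l, (e l : ℤ) = α l * p + β l * q - m := by
    intro l
    have := hi₀ l
    simp only [he]
    omega
  have hk' : IsRelationVector K (fun l => (e l : ℤ)) f k := hk.transform hdet heZ fun l => rfl
  have he0 : ∃ l, e l = 0 := ⟨i₀, Nat.sub_self _⟩
  set w : Lˣ := Units.mk0 (X ^ (q : ℤ) * Y ^ (-(p : ℤ)))
    (mul_ne_zero (zpow_ne_zero _ hX0) (zpow_ne_zero _ hY0)) with hwdef
  set u : L := X ^ a * Y ^ b with hudef
  have hu0 : u ≠ 0 := mul_ne_zero (zpow_ne_zero _ hX0) (zpow_ne_zero _ hY0)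
  have hmon : ∀ i j : ℤ, u ^ i * (w : L) ^ j = X ^ (a * i + q * j) * Y ^ (b * i - p * j) := by
    intro i j
    rw [hwdef, Units.val_mk0, hudef, mul_zpow, mul_zpow, ← zpow_mul, ← zpow_mul, ← zpow_mul,
      ← zpow_mul, mul_mul_mul_comm, ← zpow_add₀ hX0, ← zpow_add₀ hY0]
    congr 2
    ring
  let _ : Algebra (ToricRing K) L := (toricMap (K := K) u w).toRingHom.toAlgebra
  have hfrac : IsFractionRing (ToricRing K) L :=
    isFractionRing_toricMap hX0 hY0 hind hgen hdet hudef rfl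
  have hmap : ∀ c : ToricRing K, algebraMap (ToricRing K) L c = toricMap u w c := fun c => rfl
  have : IsScalarTower K (ToricRing K) L :=
    .of_algebraMap_eq fun c => ((toricMap (K := K) u w).commutes c).symm
  have hn : ∀ l, X ^ α l * Y ^ β l = u ^ m * toricMap (K := K) u w (toricMonomial (e l) (f l)) := by
    intro l
    have h1 : u ^ m * (u ^ e l * (w : L) ^ f l) = u ^ ((α l * p + β l * q : ℤ)) * (w : L) ^ f l := by
      rw [← mul_assoc, ← pow_add, ← zpow_natCast]
      congr 2
      push_cast
      rw [heZ]
      ring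
    rw [toricMap_monomial, h1, hmon, ← zpow_natCast, ← zpow_natCast]
    congr 2
    · linear_combination (-(α l : ℤ)) * hdet
    · linear_combination (-(β l : ℤ)) * hdet
  have hφ : algebraMap (ToricRing K) L (toricMonomial (e 3) (f 3)) * φ +
      algebraMap (ToricRing K) L (toricPoly ![1, 1, 1, 0] e f) = 0 := by
    rw [hmap, hmap]
    refine (mul_eq_zero.mp (?_ : u ^ m * _ = 0)).resolve_left (pow_ne_zero _ hu0)
    rw [← hrelL]
    simp only [hn, toricPoly, Fin.sum_univ_four, map_add, map_smul]
    simp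
    ring
  set R := chart K (ToricRing K) φ with hR
  -- the normalization is contained in the chart
  have hXR : X ∈ R := by
    have : X = algebraMap (ToricRing K) L (toricMonomial p b) := by
      rw [hmap, toricMap_monomial, ← zpow_natCast, hmon]
      rw [show a * p + q * b = 1 by linarith, show b * p - p * b = 0 by ring]
      simp
    rw [this]
    exact algebraMap_mem_chart φ _
  have hYR : Y ∈ R := by
    have : Y = algebraMap (ToricRing K) L (toricMonomial q (-a)) := by
      rw [hmap, toricMap_monomial, ← zpow_natCast, hmon]
      rw [show a * q + q * -a = 0 by ring, show b * q - p * -a = 1 by linarith]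
      simp
    rw [this]
    exact algebraMap_mem_chart φ _
  have hAR : ∀ z : A, algebraMap A L z ∈ R := by
    intro z
    have hle : Algebra.adjoin K {x, y, τ} ≤ R.comap (IsScalarTower.toAlgHom K A L) := by
      refine Algebra.adjoin_le ?_
      rintro z (rfl | rfl | rfl)
      · exact hXR
      · exact hYR
      · exact self_mem_chart (K := K) (Q := ToricRing K) φ
    rw [hgenA] at hle
    exact hle (Algebra.mem_top (x := z))
  have hBR : ∀ z : integralClosure A L, (z : L) ∈ R := by
    intro z
    refine mem_toricChart_of_isIntegral (K := K) hk' he0 hφ ?_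
    obtain ⟨g, hg, hgz⟩ := z.2
    let ρ : A →+* R := (algebraMap A L).codRestrict R hAR
    refine ⟨g.map ρ, hg.map ρ, ?_⟩
    rw [eval₂_map]
    exact hgz
  let ρ : integralClosure A L →+* R :=
    (integralClosure A L).val.toRingHom.codRestrict R hBR
  let _ : Algebra (integralClosure A L) R := ρ.toAlgebra
  have hρ : ∀ z, ((algebraMap (integralClosure A L) R z : R) : L) = z := fun z => rfl
  have : IsScalarTower K (integralClosure A L) R := .of_algebraMap_eq fun c => rfl
  have hsR : algebraMap (integralClosure A L) R s =
      (⟨φ, self_mem_chart φ⟩ : R) - algebraMap K R t := Subtype.ext (by rw [hρ, hsL]; rfl)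
  have hsmooth : Algebra.FormallySmooth K
      (R ⧸ Ideal.span {algebraMap (integralClosure A L) R s}) := by
    rw [hsR]
    exact formallySmooth_toricChart hk' he0 ht hne hφ
  -- The inclusions `B ⊆ R ⊆ B_P` transfer formal smoothness from the toric fiber; the second holds
  -- because `φ`, `u`, `w` and `w⁻¹` are all regular at `P`.
  refine formallySmooth_localization_of_le (R := R) (fun z z' h => ?_) s 𝔭 fun r => ?_
  · exact Subtype.ext (congrArg (fun r : R => (r : L)) h)
  · have hloc : IsLocalAt P (r : L) :=
      chart_induction (K := K) (Q := ToricRing K) (isLocalAt_of_mem (hAB τ))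
        (fun c => isLocalAt_toricMap hKB hu hw hw' c) (fun _ _ => IsLocalAt.add)
        (fun _ _ => IsLocalAt.mul) r.2
    obtain ⟨g, hg, c, hc⟩ := hloc
    exact ⟨ι g, ι c, hg, Subtype.ext hc⟩

/-- Formal smoothness is checked prime by prime; finiteness of the normalization supplies the finite
presentation that smoothness also requires. -/
theorem smooth_fiber [IsDomain A] {x y τ : A} (hgenA : Algebra.adjoin K {x, y, τ} = ⊤)
    (hx : x ≠ 0) (hy : y ≠ 0)
    (hind : AlgebraicIndependent K ![x, y])
    {α β : Fin 4 → ℕ} (hdist : ∀ i j, i ≠ j → α i ≠ α j ∨ β i ≠ β j)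
    (hrel : ∑ l, ![1, 1, 1, τ] l * (x ^ α l * y ^ β l) = 0)
    {k : Fin 4 → ℤ} (hk : IsRelationVector K (fun l => (α l : ℤ)) (fun l => (β l : ℤ)) k)
    {t : K} (ht : t ≠ 0) (hne : t ^ k 3 ≠ ∏ i with k i ≠ 0, (k i : K) ^ k i)
    (s : integralClosure A L)
    (hs : s = algebraMap A (integralClosure A L) (τ - algebraMap K A t)) :
    Algebra.Smooth K (integralClosure A L ⧸ Ideal.span {s}) := by
  have hAL : Function.Injective (algebraMap A L) := IsFractionRing.injective A L
  have hgen := adjoin_pair_eq_top (L := L) hgenA (by rwa [Ne, map_eq_zero_iff _ hAL])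
    (by rwa [Ne, map_eq_zero_iff _ hAL]) hrel
  have hind' : AlgebraicIndependent K ![algebraMap A L x, algebraMap A L y] := by
    convert hind.map' (f := IsScalarTower.toAlgHom K A L) hAL using 1
    ext i
    fin_cases i <;> rfl
  have hft : Algebra.FiniteType K A := by
    classical
    refine ⟨⟨{x, y, τ}, ?_⟩⟩
    rw [← hgenA]
    simp
  have hfin : Module.Finite A (integralClosure A L) := finite_integralClosure K A L
  have : Algebra.FiniteType K (integralClosure A L) := .trans (S := A) hft inferInstance
  have : Algebra.FiniteType K (integralClosure A L ⧸ Ideal.span {s}) :=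
    .of_surjective (Ideal.Quotient.mkₐ K (Ideal.span {s})) Ideal.Quotient.mk_surjective
  have : Algebra.FinitePresentation K (integralClosure A L ⧸ Ideal.span {s}) :=
    Algebra.FinitePresentation.of_finiteType.mp this
  refine ⟨Algebra.smoothLocus_eq_univ_iff.mp (Set.eq_univ_of_forall fun 𝔭 => ?_), this⟩
  exact formallySmooth_atPrime hgenA hx hy hind' hgen hdist hrel hk ht hne s hs 𝔭.asIdeal

end Core

end Delsarte

end

noncomputable section

namespace Delsarte

open MvPolynomial

/-! ### Exponent matrix and relation vector of the pencil -/

section Exponents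

variable {K : Type*} [Field K] {A : Matrix (Fin 4) (Fin 4) ℕ}

theorem pencilMatrix_injective
    (hN : ∀ i j, i ≠ j → pencilMonomial K A K i ≠ pencilMonomial K A K j) :
    Function.Injective (pencilMatrix K A) := by
  intro i j h
  by_contra hij
  exact hN i j hij (by simp only [pencilMonomial, h])

variable [CharZero K]

/-- The value of `F` at `(1, 1, 0, 0)` counts the monomials free of `X₂` and `X₃`, and in
characteristic zero this count must vanish. Hence the truncated subtraction in `pencilMatrix` is
exact. -/
theorem ContainsLine.exponent_pos (h : ContainsLine K A) (i : Fin 4) : 1 ≤ A i 2 + A i 3 := by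
  have h1 := h ![1, 1, 0, 0] rfl rfl
  have h2 : ((∑ i, if A i 2 + A i 3 = 0 then 1 else 0 : ℕ) : K) = 0 := by
    rw [← h1, poly, map_sum, Nat.cast_sum]
    refine Finset.sum_congr rfl fun l _ => ?_
    rw [map_prod, Fin.prod_univ_four]
    by_cases h3 : A l 2 = 0 <;> by_cases h4 : A l 3 = 0 <;> simp [h3, h4]
  rw [Nat.cast_eq_zero, Finset.sum_eq_zero_iff] at h2
  have := h2 i (Finset.mem_univ i)
  by_contra h3
  rw [if_pos (by omega)] at this
  exact one_ne_zero this

theorem exists_shift (A : Matrix (Fin 4) (Fin 4) ℕ) :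
    ∃ ε : ℕ, ∀ i, pencilMatrix K A i 2 + ε = A i 2 + A i 3 := by
  by_cases h : ContainsLine K A
  · refine ⟨1, fun i => ?_⟩
    have := h.exponent_pos i
    simp only [pencilMatrix, if_pos h, Matrix.cons_val]
    omega
  · exact ⟨0, fun i => by simp [pencilMatrix, if_neg h]⟩

theorem IsMinimalFibration.exists_degree (hA : IsMinimalFibration K A) :
    ∃ d : ℕ, ∀ i, ∑ j, pencilMatrix K A i j = d := by
  obtain ⟨d, hd⟩ := hA.homogeneous
  obtain ⟨ε, hε⟩ := exists_shift (K := K) A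
  refine ⟨d - ε, fun i => ?_⟩
  have h1 := hd i
  have h2 := hε i
  have h3 : pencilMatrix K A i 0 = A i 0 := rfl
  have h4 : pencilMatrix K A i 1 = A i 1 := rfl
  rw [Fin.sum_univ_four] at h1
  rw [Fin.sum_univ_three]
  omega

/-- The equation of the generic fiber is not divisible by a coordinate. -/
theorem IsMinimalFibration.exists_eq_zero (hA : IsMinimalFibration K A)
    (hinj : Function.Injective (pencilMatrix K A)) (a : Fin 3) : ∃ l, pencilMatrix K A l a = 0 := by
  by_contra! hne
  set s : Fin 4 → Fin 3 →₀ ℕ := fun l => Finsupp.equivFunOnFinite.symm (pencilMatrix K A l) with hs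
  set c : Fin 4 → RatFunc K := ![1, 1, 1, RatFunc.X] with hc
  have hc0 : ∀ l, c l ≠ 0 := by
    intro l
    fin_cases l <;> simp [hc, RatFunc.X_ne_zero]
  have hsinj : Function.Injective s := Finsupp.equivFunOnFinite.symm.injective.comp hinj
  have hmon : ∀ l, pencilMonomial K A (RatFunc K) l = monomial (s l) 1 := by
    intro l
    rw [pencilMonomial, monomial_eq, C_1, one_mul, Finsupp.prod_fintype _ _ fun _ => pow_zero _]
    rfl
  have hmap : ∀ l, map (algebraMap (Polynomial K) (RatFunc K)) (pencilMonomial K A _ l) =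
      pencilMonomial K A (RatFunc K) l := by
    intro l
    simp [pencilMonomial]
  have hG : genericFiber K A = ∑ l, monomial (s l) (c l) := by
    rw [genericFiber, pencil, map_add, map_add, map_add, map_mul, map_C, hmap, hmap, hmap, hmap,
      Fin.sum_univ_four, hmon, hmon, hmon, hmon, C_mul_monomial]
    simp [hc]
  have hcoeff : ∀ l, coeff (s l) (genericFiber K A) = c l := by
    intro l
    rw [hG, coeff_sum, Finset.sum_eq_single l]
    · simp
    · intro l' _ hl
      rw [coeff_monomial, if_neg fun h => hl (hsinj h)]
    · simp
  obtain ⟨H, hH⟩ : X a ∣ genericFiber K A := by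
    rw [hG]
    refine Finset.dvd_sum fun l _ => ?_
    rw [X_dvd_monomial]
    exact Or.inr (hne l)
  rcases hA.irreducible.isUnit_or_isUnit hH with hu | hu
  · exact (X_prime (R := RatFunc K) (i := a)).not_isUnit hu
  · rw [MvPolynomial.isUnit_iff_eq_C_of_isReduced] at hu
    obtain ⟨v, -, rfl⟩ := hu
    have h1 : ∀ l, s l = Finsupp.single a 1 := by
      intro l
      by_contra h
      refine hc0 l ?_
      rw [← hcoeff, hH, mul_comm, coeff_C_mul, coeff_X, if_neg (Ne.symm h), mul_zero]
    exact absurd (hsinj ((h1 0).trans (h1 1).symm)) (by decide)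

/-- By homogeneity, the constant vector and two columns of the exponent matrix determine the third
column. Invertibility of `A` then leaves only a line of relations, even over `K`. -/
theorem IsMinimalFibration.isRelationVector (hA : IsMinimalFibration K A)
    (hinj : Function.Injective (pencilMatrix K A)) {k : Fin 4 → ℤ} (hk : IsKernelVector K A k)
    (j : Fin 3) :
    IsRelationVector K (fun l => (pencilMatrix K A l (j.succAbove 0) : ℤ))
      (fun l => (pencilMatrix K A l (j.succAbove 1) : ℤ)) k := by
  obtain ⟨d, hd⟩ := hA.exists_degree
  have hcol : ∀ i, ∑ l, (pencilMatrix K A l i : ℤ) * k l = 0 := by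
    intro i
    have := congrFun hk.vecMul_eq_zero i
    simpa [Matrix.vecMul, dotProduct, mul_comm] using this
  have hd0 : d ≠ 0 := by
    rintro rfl
    have h0 : ∀ l, pencilMatrix K A l = 0 := fun l => funext fun i =>
      Finset.sum_eq_zero_iff.mp (hd l) i (Finset.mem_univ i)
    exact absurd (hinj ((h0 0).trans (h0 1).symm)) (by decide)
  have hsum : ∑ l, k l = 0 := by
    refine (mul_eq_zero.mp (?_ : (d : ℤ) * ∑ l, k l = 0)).resolve_left (by exact_mod_cast hd0)
    rw [Finset.mul_sum]
    calc ∑ l, (d : ℤ) * k l = ∑ l, ∑ i, (pencilMatrix K A l i : ℤ) * k l := by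
          refine Finset.sum_congr rfl fun l _ => ?_
          rw [← Finset.sum_mul, ← hd l]
          push_cast
          rfl
      _ = 0 := by
          rw [Finset.sum_comm]
          exact Finset.sum_eq_zero fun i _ => hcol i
  have hk3 : (k 3 : K) ≠ 0 := by exact_mod_cast hk.pos.ne'
  refine ⟨hsum, hcol _, hcol _, hk.pos.ne', fun z z1 z2 z3 => ⟨z 3 / k 3, ?_⟩⟩
  have hcolz : ∀ i, ∑ l, (pencilMatrix K A l i : K) * z l = 0 := by
    have hz : ∑ i, ∑ l, (pencilMatrix K A l i : K) * z l = 0 := by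
      rw [Finset.sum_comm]
      calc ∑ l, ∑ i, (pencilMatrix K A l i : K) * z l = ∑ l, (d : K) * z l := by
            refine Finset.sum_congr rfl fun l _ => ?_
            rw [← Finset.sum_mul, ← hd l]
            push_cast
            rfl
        _ = 0 := by rw [← Finset.mul_sum, z1, mul_zero]
    simp only [Int.cast_natCast] at z2 z3
    rw [Fin.sum_univ_succAbove _ j, Fin.sum_univ_two, z2, z3, add_zero, add_zero] at hz
    intro i
    rcases Fin.eq_self_or_eq_succAbove j i with rfl | ⟨i, rfl⟩
    · exact hz
    · fin_cases i
      · exact z2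
      · exact z3
  have hcolk : ∀ i, ∑ l, (pencilMatrix K A l i : K) * k l = 0 := by
    intro i
    have := congrArg (Int.cast : ℤ → K) (hcol i)
    push_cast at this
    exact this
  have hsumk : ∑ l, (k l : K) = 0 := by
    have := congrArg (Int.cast : ℤ → K) hsum
    push_cast at this
    exact this
  -- This combination has last entry zero, so it is also orthogonal to the column `(0, 0, 0, 1)` of
  -- `A`. It is therefore orthogonal to all columns of `A`, and vanishes.
  set w : Fin 4 → K := fun l => k 3 * z l - z 3 * k l with hw
  have hw3 : w 3 = 0 := by simp only [hw]; ring
  have hsumw : ∑ l, w l = 0 := by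
    simp only [hw, Finset.sum_sub_distrib, ← Finset.mul_sum, z1, hsumk, mul_zero, sub_zero]
  have hcolw : ∀ i, ∑ l, w l * (pencilMatrix K A l i : K) = 0 := by
    intro i
    have h1 : ∀ l, w l * (pencilMatrix K A l i : K) = k 3 * ((pencilMatrix K A l i : K) * z l) -
        z 3 * ((pencilMatrix K A l i : K) * k l) := fun l => by simp only [hw]; ring
    simp only [h1, Finset.sum_sub_distrib, ← Finset.mul_sum, hcolz, hcolk, mul_zero, sub_zero]
  obtain ⟨ε, hε⟩ := exists_shift (K := K) A
  have hw2 : ∑ l, w l * (A l 2 : K) = 0 := by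
    simp [hA.exponent_t, hw3]
  have hdet : (A.map (Nat.cast : ℕ → K)).det ≠ 0 := by
    have h1 : ((A.map (Nat.cast : ℕ → ℤ)).map (Int.castRingHom K)) = A.map (Nat.cast : ℕ → K) := by
      ext
      simp
    rw [← h1, ← RingHom.mapMatrix_apply, ← RingHom.map_det]
    simpa using hA.det_ne_zero
  have hw0 : w = 0 := by
    refine Matrix.eq_zero_of_vecMul_eq_zero hdet (funext fun i => ?_)
    rw [Matrix.vecMul, dotProduct]
    simp only [Matrix.map_apply, Pi.zero_apply]
    fin_cases i
    · exact hcolw 0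
    · exact hcolw 1
    · exact hw2
    · have h1 : ∀ l, w l * (A l 3 : K) =
          w l * (pencilMatrix K A l 2 : K) + w l * (ε : K) - w l * (A l 2 : K) := by
        intro l
        have := congrArg (Nat.cast : ℕ → K) (hε l)
        push_cast at this
        linear_combination w l * (-this)
      change ∑ l, w l * (A l 3 : K) = 0
      simp only [h1, Finset.sum_sub_distrib, Finset.sum_add_distrib, hcolw, hw2, ← Finset.sum_mul,
        hsumw]
      ring
  intro l
  have := congrFun hw0 l
  simp only [hw, Pi.zero_apply] at this
  field_simp
  linear_combination this

end Exponents

/-! ### Coprimality of the coefficients of the pencil -/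

section Coprime

variable {K σ : Type*} [Field K] [CharZero K] [Fintype σ]

/-- The last of four monomials is coprime to the sum of the others if they have no common
divisor. -/
theorem isRelPrime_monomial {e : Fin 4 → σ → ℕ} (he : ∀ i, ∃ l, e l i = 0) :
    IsRelPrime (∏ i, X i ^ e 3 i : MvPolynomial σ K)
      (∏ i, X i ^ e 0 i + ∏ i, X i ^ e 1 i + ∏ i, X i ^ e 2 i) := by
  classical
  refine IsRelPrime.prod_left fun i _ => ?_
  rcases Nat.eq_zero_or_pos (e 3 i) with h | h
  · rw [h, pow_zero]
    exact isRelPrime_one_left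
  refine IsRelPrime.pow_left ?_
  rw [X_prime.irreducible.isRelPrime_iff_not_dvd]
  rintro ⟨q, hq⟩
  -- Setting `X i = 0` and the other variables to `1` counts the monomials not divisible by `X i`;
  -- the count is nonzero in characteristic zero.
  have hev : ∀ l, eval (Function.update 1 i (0 : K)) (∏ i, X i ^ e l i) =
      ((if e l i = 0 then 1 else 0 : ℕ) : K) := by
    intro l
    rw [map_prod, Finset.prod_eq_single i]
    · simp [zero_pow_eq]
    · intro i' _ hi
      simp [hi]
    · simp
  have h1 := congrArg (eval (Function.update 1 i (0 : K))) hq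
  rw [map_mul, eval_X, Function.update_self, zero_mul, map_add, map_add, hev, hev, hev] at h1
  norm_cast at h1
  obtain ⟨l, hl⟩ := he i
  fin_cases l
  · simp_all
  · simp_all
  · simp_all
  · exact h.ne' hl

end Coprime

end Delsarte

end

noncomputable section

namespace Delsarte

open MvPolynomial

/-! ### Rational parametrization and integrality of the charts -/

section ChartRing

variable (K : Type*) [Field K] (j : Fin 3)

/-- Substitution of `1` for `X_j`. -/
def dehomogenize :
    MvPolynomial (Fin 3) (Polynomial K) →+* Polynomial (MvPolynomial (Fin 2) K) :=
  eval₂Hom (Polynomial.mapRingHom C) (j.insertNth 1 fun i => Polynomial.C (X i))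

/-- The inclusion of the polynomials without `X_j`. -/
def rehomogenize :
    Polynomial (MvPolynomial (Fin 2) K) →+* MvPolynomial (Fin 3) (Polynomial K) :=
  Polynomial.eval₂RingHom (eval₂Hom (C.comp Polynomial.C) fun i => X (j.succAbove i))
    (C Polynomial.X)

variable {K}

theorem rehomogenize_dehomogenize_sub_mem (p : MvPolynomial (Fin 3) (Polynomial K)) :
    rehomogenize K j (dehomogenize K j p) - p ∈
      Ideal.span {(X j - 1 : MvPolynomial (Fin 3) (Polynomial K))} := by
  rw [← Ideal.Quotient.eq]
  suffices h : ((Ideal.Quotient.mk (Ideal.span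
      {(X j - 1 : MvPolynomial (Fin 3) (Polynomial K))})).comp (rehomogenize K j)).comp
      (dehomogenize K j) = Ideal.Quotient.mk _ from RingHom.congr_fun h p
  refine MvPolynomial.ringHom_ext' (Polynomial.ringHom_ext' ?_ ?_) fun i => ?_
  · ext c
    simp [dehomogenize, rehomogenize]
  · simp [dehomogenize, rehomogenize]
  · rcases Fin.eq_self_or_eq_succAbove j i with rfl | ⟨i, rfl⟩
    · have : Ideal.Quotient.mk (Ideal.span
          {(X i - 1 : MvPolynomial (Fin 3) (Polynomial K))}) (X i) = 1 := by
        rw [← map_one (Ideal.Quotient.mk _), Ideal.Quotient.eq]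
        exact Ideal.mem_span_singleton_self _
      simp [dehomogenize, this]
    · simp [dehomogenize, rehomogenize]

variable (K) (A : Matrix (Fin 4) (Fin 4) ℕ)

/-- The dehomogenization of the `l`-th monomial. -/
def affineMonomial (l : Fin 4) : MvPolynomial (Fin 2) K :=
  ∏ i, X i ^ pencilMatrix K A l (j.succAbove i)

theorem dehomogenize_pencilMonomial (l : Fin 4) :
    dehomogenize K j (pencilMonomial K A (Polynomial K) l) =
      Polynomial.C (affineMonomial K j A l) := by
  simp [pencilMonomial, affineMonomial, dehomogenize, Fin.prod_univ_succAbove _ j]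

theorem dehomogenize_pencil :
    dehomogenize K j (pencil K A) = Polynomial.C (affineMonomial K j A 3) * Polynomial.X +
      Polynomial.C (affineMonomial K j A 0 + affineMonomial K j A 1 + affineMonomial K j A 2) := by
  have hX : dehomogenize K j (C Polynomial.X) = Polynomial.X := by simp [dehomogenize]
  rw [pencil, map_add, map_add, map_add, map_mul, hX]
  simp only [dehomogenize_pencilMonomial, map_add]
  ring

/-- The value of `t` in the field of rational functions in two variables. -/
def parameter : FractionRing (MvPolynomial (Fin 2) K) :=
  - algebraMap _ _ (affineMonomial K j A 0 + affineMonomial K j A 1 + affineMonomial K j A 2) /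
    algebraMap _ _ (affineMonomial K j A 3)

theorem affineMonomial_ne_zero (l : Fin 4) : affineMonomial K j A l ≠ 0 :=
  Finset.prod_ne_zero_iff.mpr fun i _ => pow_ne_zero _ (X_ne_zero i)

theorem parameter_spec :
    algebraMap _ _ (affineMonomial K j A 3) * parameter K j A +
      algebraMap _ _ (affineMonomial K j A 0 + affineMonomial K j A 1 + affineMonomial K j A 2) =
      0 := by
  have h : algebraMap _ (FractionRing (MvPolynomial (Fin 2) K)) (affineMonomial K j A 3) ≠ 0 := by
    rw [Ne, map_eq_zero_iff _ (IsFractionRing.injective _ _)]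
    exact affineMonomial_ne_zero K j A 3
  rw [parameter, mul_div_cancel₀ _ h, neg_add_cancel]

/-- The rational parametrization of the family. -/
def parametrize :
    MvPolynomial (Fin 3) (Polynomial K) →+* FractionRing (MvPolynomial (Fin 2) K) :=
  (Polynomial.aeval (R := MvPolynomial (Fin 2) K) (parameter K j A)).toRingHom.comp
    (dehomogenize K j)

theorem parametrize_pencil : parametrize K j A (pencil K A) = 0 := by
  change Polynomial.aeval _ (dehomogenize K j (pencil K A)) = 0
  rw [dehomogenize_pencil]
  simpa using parameter_spec K j A

theorem parametrize_X_self : parametrize K j A (X j) = 1 := by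
  simp [parametrize, dehomogenize]

theorem parametrize_X_succAbove (i : Fin 2) :
    parametrize K j A (X (j.succAbove i)) = algebraMap _ _ (X i : MvPolynomial (Fin 2) K) := by
  simp [parametrize, dehomogenize]

variable {K A} [CharZero K]

/-- After dehomogenizing, `G` is linear in `t` with coprime coefficients, so it generates the kernel
of substituting the rational function for `t`. The chart ring thus embeds in a field of rational
functions. -/
theorem ker_parametrize (hzero : ∀ a, ∃ l, pencilMatrix K A l a = 0) :
    RingHom.ker (parametrize K j A) = Ideal.span {pencil K A, X j - 1} := by
  apply le_antisymm
  · intro p hp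
    obtain ⟨q, hq⟩ := dvd_of_aeval_eq_zero (IsFractionRing.injective _ _)
      (affineMonomial_ne_zero K j A 3) (parameter_spec K j A)
      (fun z hz => (isRelPrime_monomial fun i => hzero (j.succAbove i)).dvd_of_dvd_mul_left hz)
      (dehomogenize K j p) hp
    rw [← dehomogenize_pencil] at hq
    have hle : Ideal.span {(X j - 1 : MvPolynomial (Fin 3) (Polynomial K))} ≤
        Ideal.span {pencil K A, X j - 1} := Ideal.span_mono (by simp)
    have hG : pencil K A ∈ Ideal.span {pencil K A, X j - 1} := Ideal.subset_span (by simp)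
    have h1 := hle (rehomogenize_dehomogenize_sub_mem j p)
    have h2 := hle (rehomogenize_dehomogenize_sub_mem j (pencil K A))
    have h3 := (Submodule.sub_mem_iff_left _ hG).mp h2
    rw [hq, map_mul] at h1
    exact (Submodule.sub_mem_iff_right _ (Ideal.mul_mem_right _ _ h3)).mp h1
  · rw [Ideal.span_le]
    rintro p (rfl | rfl)
    · exact parametrize_pencil K j A
    · change parametrize K j A _ = 0
      rw [map_sub, parametrize_X_self, map_one, sub_self]

/-- The parametrization as an embedding of the coordinate ring of the chart. -/
def chartRingHom (hzero : ∀ a, ∃ l, pencilMatrix K A l a = 0) :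
    ChartRing K A j →ₐ[K] FractionRing (MvPolynomial (Fin 2) K) where
  toRingHom := Ideal.Quotient.lift _ (parametrize K j A) fun p hp => by
    rwa [← RingHom.mem_ker, ker_parametrize j hzero]
  commutes' c := by
    change parametrize K j A (C (Polynomial.C c)) = _
    simp [parametrize, dehomogenize, IsScalarTower.algebraMap_apply K (MvPolynomial (Fin 2) K)
      (FractionRing (MvPolynomial (Fin 2) K))]

theorem chartRingHom_injective (hzero : ∀ a, ∃ l, pencilMatrix K A l a = 0) :
    Function.Injective (chartRingHom j hzero) :=
  RingHom.lift_injective_of_ker_le_ideal _ _ (ker_parametrize j hzero).le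

theorem isDomain_chartRing (hzero : ∀ a, ∃ l, pencilMatrix K A l a = 0) :
    IsDomain (ChartRing K A j) :=
  (chartRingHom_injective j hzero).isDomain (chartRingHom j hzero).toRingHom

end ChartRing

/-! ### Generators and the four-term relation on a chart -/

section Chart

variable {K : Type*} [Field K] (A : Matrix (Fin 4) (Fin 4) ℕ) (j : Fin 3)

/-- The coordinate functions on a chart. -/
def chartX (i : Fin 3) : ChartRing K A j := Ideal.Quotient.mk _ (X i)

/-- The coordinate of the base as a function on a chart. -/
def chartT : ChartRing K A j := Ideal.Quotient.mk _ (C Polynomial.X)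

theorem chartX_self : chartX (K := K) A j j = 1 := by
  rw [chartX, ← map_one (Ideal.Quotient.mk _), Ideal.Quotient.eq]
  exact Ideal.subset_span (by simp)

theorem adjoin_chart :
    Algebra.adjoin K {chartX A j (j.succAbove 0), chartX A j (j.succAbove 1), chartT A j} =
      (⊤ : Subalgebra K (ChartRing K A j)) := by
  set S := Algebra.adjoin K
    {chartX (K := K) A j (j.succAbove 0), chartX A j (j.succAbove 1), chartT A j} with hS
  refine eq_top_iff.mpr fun z hz => ?_
  clear hz
  obtain ⟨p, rfl⟩ := Ideal.Quotient.mk_surjective z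
  induction p using MvPolynomial.induction_on with
  | C q =>
    induction q using Polynomial.induction_on' with
    | add p q hp hq =>
      rw [map_add, map_add]
      exact add_mem hp hq
    | monomial n c =>
      rw [← Polynomial.C_mul_X_pow_eq_monomial, map_mul, map_mul, map_pow, map_pow]
      refine mul_mem (S.algebraMap_mem c) (pow_mem (Algebra.subset_adjoin ?_) n)
      simp [chartT]
  | add p q hp hq =>
    rw [map_add]
    exact add_mem hp hq
  | mul_X p i hp =>
    rw [map_mul]
    refine mul_mem hp ?_
    change chartX A j i ∈ S
    rcases Fin.eq_self_or_eq_succAbove j i with rfl | ⟨i, rfl⟩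
    · rw [chartX_self]
      exact one_mem S
    · refine Algebra.subset_adjoin ?_
      fin_cases i <;> simp

theorem chart_relation :
    ∑ l, ![1, 1, 1, chartT (K := K) A j] l *
      (chartX A j (j.succAbove 0) ^ pencilMatrix K A l (j.succAbove 0) *
        chartX A j (j.succAbove 1) ^ pencilMatrix K A l (j.succAbove 1)) = 0 := by
  have h1 : ∀ l, Ideal.Quotient.mk (Ideal.span {pencil K A, X j - 1})
      (pencilMonomial K A (Polynomial K) l) =
      chartX A j (j.succAbove 0) ^ pencilMatrix K A l (j.succAbove 0) *
        chartX A j (j.succAbove 1) ^ pencilMatrix K A l (j.succAbove 1) := by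
    intro l
    rw [pencilMonomial, map_prod, Fin.prod_univ_succAbove _ j, Fin.prod_univ_two]
    simp only [map_pow]
    change chartX A j j ^ _ * _ = _
    rw [chartX_self, one_pow, one_mul]
    rfl
  have h2 : Ideal.Quotient.mk (Ideal.span {pencil K A, X j - 1})
      (pencilMonomial K A (Polynomial K) 0 + pencilMonomial K A (Polynomial K) 1 +
        pencilMonomial K A (Polynomial K) 2 +
        C Polynomial.X * pencilMonomial K A (Polynomial K) 3) = 0 :=
    Ideal.Quotient.eq_zero_iff_mem.mpr (Ideal.subset_span (Set.mem_insert _ _))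
  rw [map_add, map_add, map_add, map_mul, h1, h1, h1, h1] at h2
  simpa [Fin.sum_univ_four, chartT] using h2

variable {A} [CharZero K]

theorem chartRingHom_chartX (hzero : ∀ a, ∃ l, pencilMatrix K A l a = 0) (i : Fin 2) :
    chartRingHom j hzero (chartX A j (j.succAbove i)) =
      algebraMap _ _ (X i : MvPolynomial (Fin 2) K) :=
  parametrize_X_succAbove K j A i

theorem chartX_succAbove_ne_zero (hzero : ∀ a, ∃ l, pencilMatrix K A l a = 0) (i : Fin 2) :
    chartX (K := K) A j (j.succAbove i) ≠ 0 := by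
  intro h
  have := chartRingHom_chartX j hzero i
  rw [h, map_zero, eq_comm, map_eq_zero_iff _ (IsFractionRing.injective _ _)] at this
  exact X_ne_zero i this

theorem algebraicIndependent_chartX (hzero : ∀ a, ∃ l, pencilMatrix K A l a = 0) :
    AlgebraicIndependent K
      ![chartX (K := K) A j (j.succAbove 0), chartX A j (j.succAbove 1)] := by
  rw [algebraicIndependent_iff_injective_aeval]
  have h : (chartRingHom j hzero).comp (aeval
      ![chartX (K := K) A j (j.succAbove 0), chartX A j (j.succAbove 1)]) =
      IsScalarTower.toAlgHom K (MvPolynomial (Fin 2) K)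
        (FractionRing (MvPolynomial (Fin 2) K)) := by
    refine algHom_ext fun i => ?_
    rw [AlgHom.comp_apply, aeval_X]
    fin_cases i
    · exact chartRingHom_chartX j hzero 0
    · exact chartRingHom_chartX j hzero 1
  refine Function.Injective.of_comp (f := chartRingHom j hzero) ?_
  rw [← AlgHom.coe_comp, h]
  exact IsFractionRing.injective _ _

end Chart

/-! ### Conclusion -/

section Main

variable {K : Type*} [Field K] [IsAlgClosed K] [CharZero K] {A : Matrix (Fin 4) (Fin 4) ℕ}

/-- The fiber over a non-critical value is smooth if the monomials are distinct. -/
theorem IsMinimalFibration.smooth_fiberChartRing (hA : IsMinimalFibration K A)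
    (hinj : Function.Injective (pencilMatrix K A)) {k : Fin 4 → ℤ} (hk : IsKernelVector K A k)
    {t : K} (ht : t ≠ 0) (hne : t ^ k 3 ≠ ∏ i with k i ≠ 0, (k i : K) ^ k i) (j : Fin 3) :
    Algebra.Smooth K (FiberChartRing K A t j) := by
  have hzero := hA.exists_eq_zero hinj
  have : IsDomain (ChartRing K A j) := isDomain_chartRing j hzero
  have hcoord := chartX_succAbove_ne_zero j hzero
  obtain ⟨d, hd⟩ := hA.exists_degree
  refine smooth_fiber (adjoin_chart A j) (hcoord 0) (hcoord 1)
    (algebraicIndependent_chartX j hzero) (fun i i' hi => ?_) (chart_relation A j)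
    (hA.isRelationVector hinj hk j) ht hne _ ?_
  -- Equal total degrees make two exponent vectors agree as soon as their two affine exponents
  -- agree.
  · by_contra! h
    refine hi (hinj (funext fun a => ?_))
    have h1 := (hd i).trans (hd i').symm
    rw [Fin.sum_univ_succAbove _ j, Fin.sum_univ_succAbove _ j, Fin.sum_univ_two,
      Fin.sum_univ_two, h.1, h.2] at h1
    rcases Fin.eq_self_or_eq_succAbove j a with rfl | ⟨a, rfl⟩
    · omega
    · fin_cases a
      · exact h.1
      · exact h.2
  · rw [IsScalarTower.algebraMap_apply (Polynomial K) (ChartRing K A j), map_sub]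
    rfl

end Main

end Delsarte

end

theorem mainTheorem5 (K : Type*) [Field K] [IsAlgClosed K] [CharZero K]
    (A : Matrix (Fin 4) (Fin 4) ℕ) (hA : Delsarte.IsMinimalFibration K A)
    (k : Fin 4 → ℤ) (hk : Delsarte.IsKernelVector K A k)
    (t₀ : K) (ht₀ : t₀ ≠ 0) (hsing : Delsarte.SingularFiber K A t₀) :
    t₀ ^ k 3 = ∏ i with k i ≠ 0, (k i : K) ^ k i ∨
      ∃ i j : Fin 4, i ≠ j ∧
        Delsarte.pencilMonomial K A K i = Delsarte.pencilMonomial K A K j := by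
  by_contra! h
  exact hsing (hA.smooth_fiberChartRing (Delsarte.pencilMatrix_injective h.2) hk ht₀ h.1)
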